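/- **Ray limits for mixed logit.** Let $J\ge 1$ be the number of inside goods, $\delta_1,\dots,\delta_J\in\mathbb R$ their mean utilities, $M>0$ the market size, and $F$ the law of a random price coefficient $\alpha$. Consider the mixed-logit demand system $$q_j(\mathbf p)=M\int\frac{\exp(\delta_j-\alpha p_j)}{1+\sum_{\ell=1}^J\exp(\delta_\ell-\alpha p_\ell)}\,dF(\alpha),\qquad j=1,\dots,J,$$ and set $$\delta_{jk}(\mathbf p)=-\frac{\partial_{p_k}q_j(\mathbf p)}{\partial_{p_j}q_j(\mathbf p)},\qquad \kappa^{j}_{kj}(\mathbf p)=\frac{q_j(\mathbf p)\,\partial_{p_jp_k}q_j(\mathbf p)}{\partial_{p_k}q_j(\mathbf p)\,\partial_{p_j}q_j(\mathbf p)}$$ (with $k=j$ allowed in the second formula). In both cases below, all partial derivatives appearing in these two expressions exist at every $\mathbf p\in\mathbb R_{++}^J$ and the denominators do not vanish there. Fix $\mathbf p\in\mathbb R_{++}^J$ and let $\mathbf p^{(n)}=\lambda_n\mathbf p$ with $\lambda_n\to\infty$. (a) *Log-normal mixing.* If $\alpha\sim\log\mathcal N(\mu,\sigma^2)$ with $\mu\in\mathbb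 R$, $\sigma>0$, then for each $j$ and each $k\ne j$ $$-2+\kappa^j_{jj}(\mathbf p^{(n)})\to-1,\qquad \delta_{jk}(\mathbf p^{(n)})\bigl(1-\kappa^j_{kj}(\mathbf p^{(n)})\bigr)\to0.$$ (b) *Gamma mixing.* Let $\alpha\sim\mathrm{Gamma}(r,\beta)$ with shape $r>0$ and rate $\beta>0$, and define $$H_j(\mathbf p)=\int_0^\infty z^{r-1}\frac{\exp(\delta_j-zp_j)}{1+\sum_{\ell}\exp(\delta_\ell-zp_\ell)}\,dz,\qquad C_j(\mathbf p)=\frac1{\Gamma(r)}\int_0^\infty\frac{u^{r-1}e^{-u}}{1+\sum_{\ell}\exp\bigl(\delta_\ell-\tfrac{p_\ell}{p_j}u\bigr)}\,du.$$ For $\mathbf p\in\mathbb R_{++}^J$ both integrals are finite, $C_j(\mathbf p)>0$, and $H_j(\mathbf p)=e^{\delta_j}\Gamma(r)p_j^{-r}C_j(\mathbf p)$. The derivatives in $$\zeta_j=-\frac{p_j}{r}\,\partial_{p_j}\log C_j,\qquad \chi_j=\frac{p_j^2}{r}\,\partial_{p_jp_j}\log C_j,\qquad \xi_{jk}=\frac{p_j^2}{r}\,\partial_{p_jp_k}\log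 C_j\quad(k\ne j)$$ exist on $\mathbb R_{++}^J$, $1+\zeta_j(\mathbf p)>0$, and for each $j$ and each $k\neq j$ $$-2+\kappa^j_{jj}(\mathbf p^{(n)})\to-1+\frac1r\,\frac{1+\chi_j(\mathbf p)}{(1+\zeta_j(\mathbf p))^2},\qquad \delta_{jk}(\mathbf p^{(n)})\bigl(1-\kappa^j_{kj}(\mathbf p^{(n)})\bigr)\to\frac1r\,\frac{\xi_{jk}(\mathbf p)}{(1+\zeta_j(\mathbf p))^2}.$$ If good $j$ has no competing inside goods ($J=1$), then $C_j$ is constant on $\mathbb R_{++}$, $\zeta_j=\chi_j=0$, and the diagonal limit is $-1+1/r$. If there are competing inside goods ($J\ge2$), then for all $j\ne k$ both limits depend on the ray, i.e. each of them, as a function of $\mathbf p\in\mathbb R_{++}^J$, is non-constant, and the off-diagonal limit is nonzero for some $\mathbf p\in\mathbb R_{++}^J$. -/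

import Mathlib

open Filter Topology MeasureTheory ProbabilityTheory

noncomputable section

namespace MixedLogit

variable {J : ℕ}

/-- The open positive orthant of price vectors. -/
def PosPrices (J : ℕ) : Set (Fin J → ℝ) := {p | ∀ i, 0 < p i}

/-- The partial derivative `∂f/∂p_i` at `p`. -/
def pderiv (i : Fin J) (f : (Fin J → ℝ) → ℝ) (p : Fin J → ℝ) : ℝ :=
  deriv (fun t => f (Function.update p i t)) (p i)

/-- The partial derivative `∂f/∂p_i` exists at `p`. -/
def HasPartialAt (i : Fin J) (f : (Fin J → ℝ) → ℝ) (p : Fin J → ℝ) : Prop :=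
  DifferentiableAt ℝ (fun t => f (Function.update p i t)) (p i)

/-- The logit choice probability of good `j` for a consumer with price coefficient `α`:
`exp (δ_j - α p_j) / (1 + ∑_ℓ exp (δ_ℓ - α p_ℓ))`. -/
def share (δ : Fin J → ℝ) (j : Fin J) (α : ℝ) (p : Fin J → ℝ) : ℝ :=
  Real.exp (δ j - α * p j) / (1 + ∑ l, Real.exp (δ l - α * p l))

/-- Mixed-logit demand with market size `M`, mean utilities `δ` and law `F` of the
price coefficient. -/
def demand (M : ℝ) (δ : Fin J → ℝ) (F : Measure ℝ) (j : Fin J) (p : Fin J → ℝ) : ℝ :=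
  M * ∫ α, share δ j α p ∂F

/-- The log-normal law: the law of `exp X` with `X` normal of mean `μ` and variance `σ ^ 2`. -/
def logNormal (μ σ : ℝ) : Measure ℝ :=
  (gaussianReal μ ⟨σ ^ 2, sq_nonneg σ⟩).map Real.exp

/-- The ratio `δ_{jk} = -(∂q_j/∂p_k) / (∂q_j/∂p_j)`. -/
def diversion (q : Fin J → (Fin J → ℝ) → ℝ) (j k : Fin J) (p : Fin J → ℝ) : ℝ :=
  -(pderiv k (q j) p / pderiv j (q j) p)

/-- The demand curvature `κ^i_{kj} = q_i (∂²q_i/∂p_j∂p_k) / ((∂q_i/∂p_k) (∂q_i/∂p_j))`. -/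
def curvature (q : Fin J → (Fin J → ℝ) → ℝ) (i k j : Fin J) (p : Fin J → ℝ) : ℝ :=
  q i p * pderiv j (pderiv k (q i)) p / (pderiv k (q i) p * pderiv j (q i) p)

/-- The diagonal term `-2 + κ^j_{jj}`. -/
def diagTerm (q : Fin J → (Fin J → ℝ) → ℝ) (j : Fin J) (p : Fin J → ℝ) : ℝ :=
  -2 + curvature q j j j p

/-- The off-diagonal term `δ_{jk} (1 - κ^j_{kj})`. -/
def offDiagTerm (q : Fin J → (Fin J → ℝ) → ℝ) (j k : Fin J) (p : Fin J → ℝ) : ℝ :=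
  diversion q j k p * (1 - curvature q j k j p)

/-- At every positive price vector the derivatives occurring in `diagTerm` and `offDiagTerm`
exist, and no denominator occurring there is zero. -/
def Regular (q : Fin J → (Fin J → ℝ) → ℝ) : Prop :=
  ∀ p ∈ PosPrices J, ∀ j k : Fin J,
    HasPartialAt k (q j) p ∧ HasPartialAt j (pderiv k (q j)) p ∧ pderiv k (q j) p ≠ 0

/-- `H_j(p) = ∫_0^∞ z^(r-1) Ψ_j(z; p) dz`, where `Ψ_j(z; p)` is `share δ j z p`. -/
def tailH (δ : Fin J → ℝ) (r : ℝ) (j : Fin J) (p : Fin J → ℝ) : ℝ :=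
  ∫ z in Set.Ioi (0 : ℝ), z ^ (r - 1) * share δ j z p

/-- The integrand of `C_j(p)`. -/
def kernelC (δ : Fin J → ℝ) (r : ℝ) (j : Fin J) (p : Fin J → ℝ) (u : ℝ) : ℝ :=
  u ^ (r - 1) * Real.exp (-u) / (1 + ∑ l, Real.exp (δ l - p l / p j * u))

/-- The market-interaction correction `C_j(p)`. -/
def tailC (δ : Fin J → ℝ) (r : ℝ) (j : Fin J) (p : Fin J → ℝ) : ℝ :=
  1 / Real.Gamma r * ∫ u in Set.Ioi (0 : ℝ), kernelC δ r j p u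

/-- `log C_j(p)`. -/
def logC (δ : Fin J → ℝ) (r : ℝ) (j : Fin J) (p : Fin J → ℝ) : ℝ :=
  Real.log (tailC δ r j p)

/-- `ζ_j(p) = -(p_j / r) ∂_{p_j} log C_j(p)`. -/
def zetaTerm (δ : Fin J → ℝ) (r : ℝ) (j : Fin J) (p : Fin J → ℝ) : ℝ :=
  -(p j / r) * pderiv j (logC δ r j) p

/-- `χ_j(p) = (p_j² / r) ∂_{p_j p_j} log C_j(p)`. -/
def chiTerm (δ : Fin J → ℝ) (r : ℝ) (j : Fin J) (p : Fin J → ℝ) : ℝ :=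
  p j ^ 2 / r * pderiv j (pderiv j (logC δ r j)) p

/-- `ξ_{jk}(p) = (p_j² / r) ∂_{p_j p_k} log C_j(p)`. -/
def xiTerm (δ : Fin J → ℝ) (r : ℝ) (j k : Fin J) (p : Fin J → ℝ) : ℝ :=
  p j ^ 2 / r * pderiv j (pderiv k (logC δ r j)) p

/-- The diagonal limit under gamma mixing, `-1 + (1/r) (1 + χ_j) / (1 + ζ_j)²`. -/
def gammaDiagLimit (δ : Fin J → ℝ) (r : ℝ) (j : Fin J) (p : Fin J → ℝ) : ℝ :=
  -1 + 1 / r * ((1 + chiTerm δ r j p) / (1 + zetaTerm δ r j p) ^ 2)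

/-- The off-diagonal limit under gamma mixing, `(1/r) ξ_{jk} / (1 + ζ_j)²`. -/
def gammaOffDiagLimit (δ : Fin J → ℝ) (r : ℝ) (j k : Fin J) (p : Fin J → ℝ) : ℝ :=
  1 / r * (xiTerm δ r j k p / (1 + zetaTerm δ r j p) ^ 2)

end MixedLogit

end

namespace MixedLogit

variable {J : ℕ}

/-! ### Calculus of the logit shares -/

/-! Differentiation under the integral turns demand and its first and second partials into integrals
of `share`, `shareD`, `shareD₂` against the mixing law. A share depends on `α` and `p` only through
`α p`, and every price derivative brings down one factor `α`. Along the ray `x • p` the variable `x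
α` therefore absorbs the scale: each integral becomes a power of `x` times a common constant times a
functional `N_x`. The two target expressions are homogeneous of degree zero, so only `N_x` survives
(`Mixing.diagTerm_smul`, `Mixing.offDiagTerm_smul`), and the question is how `N_x` behaves as `x →
∞`.

Log-normal case. In the variable `y = log (x α)`, `N_x` is integration against a fixed Gaussian
weight tilted by `e^{ay}`, with `a = (log x + μ) / σ²` tending to infinity. The tilt drives the mass
to `y = +∞`, where all shares vanish (`tendsto_tilted_average`), so the bounded share factors may be
replaced by their limits. A derivative of order `m` shifts `a` by `m`. What remains is `T(a) T(a+2)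
/ T(a+1)²` for the tilted mass `T` of demand itself, and it tends to 1 because integration by parts
gives `a T(a) / T(a+1) → p_j`.

Gamma case. Here `N_x` has density `e^{-βz/x} z^{r-1}`, which increases to `z^{r-1}`. The limits are
thus the same two expressions formed from `H_j`, which is demand under an infinite mixing measure.
Since `log C_j` is `log H_j + r log p_j` up to a constant, they translate into `ζ`, `χ`, `ξ`.

Dependence on the ray. Up to a positive factor the off-diagonal limit is `∂_j (∂_k H_j / H_j)`. Were
it zero for all `p_j`, then `∂_k H_j / H_j` would be a positive constant in `p_j`, yet it tends to 0
as `p_j → 0`. The limit also vanishes as `p_k → ∞`, so it is not constant. A constant diagonal limit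
makes `H_j` a power of `p_j`; comparison with `p_j^{-r}` forces the exponent, so `C_j` would not
depend on `p_j`, while a competitor makes it strictly decreasing in `p_j`. -/

lemma logit_denom_pos (δ : Fin J → ℝ) (α : ℝ) (p : Fin J → ℝ) :
    0 < 1 + ∑ l, Real.exp (δ l - α * p l) := by positivity

lemma share_pos (δ : Fin J → ℝ) (j : Fin J) (α : ℝ) (p : Fin J → ℝ) : 0 < share δ j α p :=
  div_pos (Real.exp_pos _) (logit_denom_pos δ α p)

lemma share_lt_one (δ : Fin J → ℝ) (j : Fin J) (α : ℝ) (p : Fin J → ℝ) : share δ j α p < 1 := by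
  rw [share, div_lt_one (logit_denom_pos δ α p)]
  have := Finset.single_le_sum (f := fun l => Real.exp (δ l - α * p l))
    (fun _ _ => (Real.exp_pos _).le) (Finset.mem_univ j)
  linarith

lemma share_le_exp (δ : Fin J → ℝ) (j : Fin J) (α : ℝ) (p : Fin J → ℝ) :
    share δ j α p ≤ Real.exp (δ j - α * p j) := by
  refine div_le_self (Real.exp_pos _).le ?_
  have : 0 ≤ ∑ l, Real.exp (δ l - α * p l) := by positivity
  linarith

lemma share_smul (δ : Fin J → ℝ) (j : Fin J) (α x : ℝ) (p : Fin J → ℝ) :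
    share δ j α (x • p) = share δ j (x * α) p := by
  simp only [share, Pi.smul_apply, smul_eq_mul]
  simp only [mul_comm x α, mul_assoc]

lemma continuous_share (δ : Fin J → ℝ) (j : Fin J) (p : Fin J → ℝ) :
    Continuous (fun α => share δ j α p) := by
  unfold share
  exact Continuous.div (by fun_prop) (by fun_prop) fun α => (logit_denom_pos δ α p).ne'

/-- The derivative of `share δ j α` in the price of good `k`. -/
noncomputable def shareD (δ : Fin J → ℝ) (j k : Fin J) (α : ℝ) (p : Fin J → ℝ) : ℝ :=
  α * (share δ j α p * (share δ k α p - if k = j then 1 else 0))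

/-- The mixed derivative of `share δ j α` in the prices of goods `k` and `j`. -/
noncomputable def shareD₂ (δ : Fin J → ℝ) (j k : Fin J) (α : ℝ) (p : Fin J → ℝ) : ℝ :=
  α ^ 2 * (share δ j α p * ((share δ j α p - 1) * (share δ k α p - if k = j then 1 else 0) +
    share δ k α p * (share δ j α p - if k = j then 1 else 0)))

lemma continuous_shareD (δ : Fin J → ℝ) (j k : Fin J) (p : Fin J → ℝ) :
    Continuous (fun α => shareD δ j k α p) := by
  have := continuous_share δ j p
  have := continuous_share δ k p
  unfold shareD; fun_prop

lemma continuous_shareD₂ (δ : Fin J → ℝ) (j k : Fin J) (p : Fin J → ℝ) :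
    Continuous (fun α => shareD₂ δ j k α p) := by
  have := continuous_share δ j p
  have := continuous_share δ k p
  unfold shareD₂; fun_prop

lemma hasDerivAt_share (δ : Fin J → ℝ) (j k : Fin J) (α : ℝ) (p : Fin J → ℝ) (t : ℝ) :
    HasDerivAt (fun t => share δ j α (Function.update p k t))
      (shareD δ j k α (Function.update p k t)) t := by
  have hexp : ∀ l : Fin J, HasDerivAt (fun t => Real.exp (δ l - α * Function.update p k t l))
      (if l = k then -α * Real.exp (δ l - α * Function.update p k t l) else 0) t := by
    intro l
    by_cases h : l = k
    · subst h
      simp only [Function.update_self, if_true]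
      have := (((hasDerivAt_id t).const_mul α).const_sub (δ l)).exp
      simp only [id, mul_one] at this
      convert this using 1; ring
    · simp only [Function.update_of_ne h, if_neg h]
      exact hasDerivAt_const _ _
  have hsum : HasDerivAt (fun t => 1 + ∑ l, Real.exp (δ l - α * Function.update p k t l))
      (-α * Real.exp (δ k - α * Function.update p k t k)) t := by
    have := (HasDerivAt.fun_sum (u := Finset.univ) fun l _ => hexp l).const_add 1
    simpa using this
  have hd := logit_denom_pos δ α (Function.update p k t)
  have := (hexp j).div hsum hd.ne'
  refine this.congr_deriv ?_
  simp only [shareD, share]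
  by_cases h : j = k
  · subst h
    simp only [if_true]
    field_simp
    ring
  · rw [if_neg h, if_neg (Ne.symm h)]
    field_simp
    ring

lemma hasDerivAt_shareD (δ : Fin J → ℝ) (j k : Fin J) (α : ℝ) (p : Fin J → ℝ) (t : ℝ) :
    HasDerivAt (fun t => shareD δ j k α (Function.update p j t))
      (shareD₂ δ j k α (Function.update p j t)) t := by
  have := ((hasDerivAt_share δ j j α p t).mul
    ((hasDerivAt_share δ k j α p t).sub_const (if k = j then (1 : ℝ) else 0))).const_mul α
  refine this.congr_deriv ?_
  simp only [shareD, shareD₂, if_true, eq_comm (a := j) (b := k)]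
  ring

/-- The good `l` is kept separate from the indices of the indicator because `shareD₂` also contains
the share of `j` minus the indicator of `k = j`. -/
lemma abs_share_sub_le (δ : Fin J → ℝ) (j k l : Fin J) (α : ℝ) (p : Fin J → ℝ) :
    |share δ l α p - if k = j then 1 else 0| ≤ 1 := by
  have h0 := share_pos δ l α p
  have h1 := share_lt_one δ l α p
  rw [abs_le]
  split_ifs <;> constructor <;> linarith

lemma abs_shareD_le (δ : Fin J → ℝ) (j k : Fin J) {α : ℝ} (hα : 0 < α) (p : Fin J → ℝ) :
    |shareD δ j k α p| ≤ α * share δ j α p := by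
  rw [shareD, abs_mul, abs_of_pos hα, abs_mul, abs_of_pos (share_pos δ j α p)]
  exact mul_le_mul_of_nonneg_left
    (mul_le_of_le_one_right (share_pos δ j α p).le (abs_share_sub_le δ j k k α p)) hα.le

lemma abs_shareD₂_le (δ : Fin J → ℝ) (j k : Fin J) (α : ℝ) (p : Fin J → ℝ) :
    |shareD₂ δ j k α p| ≤ 2 * (α ^ 2 * share δ j α p) := by
  have h0 := share_pos δ j α p
  rw [shareD₂, abs_mul, abs_of_nonneg (sq_nonneg α), abs_mul, abs_of_pos h0]
  have h1 : |(share δ j α p - 1) * (share δ k α p - if k = j then 1 else 0)| ≤ 1 := by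
    rw [abs_mul]
    refine mul_le_one₀ ?_ (abs_nonneg _) (abs_share_sub_le δ j k k α p)
    rw [abs_le]; constructor <;> linarith [share_lt_one δ j α p]
  have h2 : |share δ k α p * (share δ j α p - if k = j then 1 else 0)| ≤ 1 := by
    rw [abs_mul]
    refine mul_le_one₀ ?_ (abs_nonneg _) (abs_share_sub_le δ j k j α p)
    rw [abs_of_pos (share_pos δ k α p)]; exact (share_lt_one δ k α p).le
  have h3 := (abs_add_le ((share δ j α p - 1) * (share δ k α p - if k = j then 1 else 0))
    (share δ k α p * (share δ j α p - if k = j then 1 else 0))).trans (add_le_add h1 h2)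
  calc _ ≤ α ^ 2 * (share δ j α p * (1 + 1)) := by gcongr
    _ = _ := by ring

lemma shareD_self_neg (δ : Fin J → ℝ) (j : Fin J) {α : ℝ} (hα : 0 < α) (p : Fin J → ℝ) :
    shareD δ j j α p < 0 := by
  rw [shareD, if_pos rfl]
  exact mul_neg_of_pos_of_neg hα (mul_neg_of_pos_of_neg (share_pos δ j α p)
    (sub_neg.2 (share_lt_one δ j α p)))

lemma shareD_pos (δ : Fin J → ℝ) {j k : Fin J} (hkj : k ≠ j) {α : ℝ} (hα : 0 < α)
    (p : Fin J → ℝ) : 0 < shareD δ j k α p := by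
  rw [shareD, if_neg hkj, sub_zero]
  exact mul_pos hα (mul_pos (share_pos δ j α p) (share_pos δ k α p))

/-- The shares see only `x α`, and the single factor `α` of a first derivative equals `x⁻¹ (x α)`.
-/
lemma shareD_smul (δ : Fin J → ℝ) (j k : Fin J) (α : ℝ) {x : ℝ} (hx : 0 < x) (p : Fin J → ℝ) :
    shareD δ j k α (x • p) = x⁻¹ * shareD δ j k (x * α) p := by
  simp only [shareD, share_smul]
  field_simp

lemma shareD₂_smul (δ : Fin J → ℝ) (j k : Fin J) (α : ℝ) {x : ℝ} (hx : 0 < x) (p : Fin J → ℝ) :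
    shareD₂ δ j k α (x • p) = (x⁻¹) ^ 2 * shareD₂ δ j k (x * α) p := by
  simp only [shareD₂, share_smul]
  field_simp

lemma update_mem_posPrices {p : Fin J → ℝ} (hp : p ∈ PosPrices J) (k : Fin J) {t : ℝ}
    (ht : 0 < t) : Function.update p k t ∈ PosPrices J := by
  intro i
  by_cases h : i = k
  · subst h; simpa using ht
  · simpa [Function.update_of_ne h] using hp i

lemma smul_mem_posPrices {p : Fin J → ℝ} (hp : p ∈ PosPrices J) {x : ℝ} (hx : 0 < x) :
    x • p ∈ PosPrices J := fun i => by simpa using mul_pos hx (hp i)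

/-! ### Demand generated by a general mixing measure -/

/-- Measures on the positive half-line for which demand is twice differentiable at
positive prices. -/
structure Mixing (F : Measure ℝ) : Prop where
  pos : ∀ᵐ α ∂F, 0 < α
  integrable : ∀ (m : ℕ) (c : ℝ), 0 < c → Integrable (fun α => α ^ m * Real.exp (-(c * α))) F
  ne_zero : F ≠ 0

/-- On `α > 0` the function `α ^ m e^{-cα}` is bounded by `m! / c ^ m`, from one term of the
exponential series. Probability laws are covered this way; the integrability field is stated
separately because the gamma limit needs the infinite measure `z ^ (r - 1) dz`. -/
lemma Mixing.of_finite {F : Measure ℝ} [IsFiniteMeasure F] (hpos : ∀ᵐ α ∂F, 0 < α)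
    (hne : F ≠ 0) : Mixing F where
  pos := hpos
  ne_zero := hne
  integrable m c hc := by
    refine Integrable.of_bound (C := (m.factorial : ℝ) / c ^ m)
      (by fun_prop) ?_
    filter_upwards [hpos] with α hα
    rw [Real.norm_eq_abs, abs_of_nonneg (by positivity), Real.exp_neg,
      ← div_eq_mul_inv, div_le_div_iff₀ (Real.exp_pos _) (by positivity)]
    have := Real.pow_div_factorial_le_exp (c * α) (by positivity) m
    rw [div_le_iff₀ (by positivity), mul_pow] at this
    linarith

lemma integral_pos_of_ae_pos {F : Measure ℝ} (hF : F ≠ 0) {g : ℝ → ℝ} (hg : Integrable g F)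
    (h0 : ∀ᵐ α ∂F, 0 < g α) : 0 < ∫ α, g α ∂F := by
  rw [integral_pos_iff_support_of_nonneg_ae (h0.mono fun _ h => h.le) hg, pos_iff_ne_zero]
  intro hz
  apply hF
  rw [← ae_eq_bot, ← Filter.empty_mem_iff_bot]
  have h1 : ∀ᵐ α ∂F, g α = 0 := by
    rw [ae_iff]; exact hz
  filter_upwards [h0, h1] with α h h'
  exact absurd h' h.ne'

lemma Mixing.integral_pos {F : Measure ℝ} (hF : Mixing F) {g : ℝ → ℝ} (hg : Integrable g F)
    (h : ∀ α, 0 < α → 0 < g α) : 0 < ∫ α, g α ∂F :=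
  integral_pos_of_ae_pos hF.ne_zero hg (hF.pos.mono h)

lemma exp_sub_le_of_half {d α a b : ℝ} (hα : 0 < α) (h : a / 2 ≤ b) :
    Real.exp (d - α * b) ≤ Real.exp d * Real.exp (-(a / 2 * α)) := by
  rw [← Real.exp_add]
  apply Real.exp_le_exp.2
  nlinarith

/-- Keeps the own price above `p j / 2` while the differentiated price varies near `p k`, which
gives one dominating function `e^{-p_j α / 2}`, whether or not `k = j`. -/
lemma half_le_update {p : Fin J → ℝ} (hp : p ∈ PosPrices J) (j k : Fin J) {t : ℝ}
    (ht : t ∈ Set.Ioi (p k / 2)) : p j / 2 ≤ Function.update p k t j := by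
  by_cases h : j = k
  · subst h; simpa using (Set.mem_Ioi.1 ht).le
  · rw [Function.update_of_ne h]; linarith [hp j]

lemma Mixing.integrable_share {F : Measure ℝ} (hF : Mixing F) (δ : Fin J → ℝ) (j : Fin J)
    {p : Fin J → ℝ} (hp : p ∈ PosPrices J) : Integrable (fun α => share δ j α p) F := by
  refine ((hF.integrable 0 (p j / 2) (half_pos (hp j))).const_mul (Real.exp (δ j))).mono'
    (continuous_share δ j p).aestronglyMeasurable ?_
  filter_upwards [hF.pos] with α hα
  rw [Real.norm_eq_abs, abs_of_pos (share_pos δ j α p), pow_zero, one_mul]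
  exact (share_le_exp δ j α p).trans (exp_sub_le_of_half hα (by linarith [hp j]))

lemma Mixing.hasDerivAt_integral_share {F : Measure ℝ} (hF : Mixing F) (δ : Fin J → ℝ)
    (j k : Fin J) {p : Fin J → ℝ} (hp : p ∈ PosPrices J) :
    Integrable (fun α => shareD δ j k α p) F ∧
    HasDerivAt (fun t => ∫ α, share δ j α (Function.update p k t) ∂F)
      (∫ α, shareD δ j k α p ∂F) (p k) := by
  have := hasDerivAt_integral_of_dominated_loc_of_deriv_le (μ := F) (x₀ := p k)
    (F := fun t α => share δ j α (Function.update p k t))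
    (F' := fun t α => shareD δ j k α (Function.update p k t)) (s := Set.Ioi (p k / 2))
    (bound := fun α => Real.exp (δ j) * (α ^ 1 * Real.exp (-(p j / 2 * α))))
    (Ioi_mem_nhds (half_lt_self (hp k)))
    (Eventually.of_forall fun t => (continuous_share δ j _).aestronglyMeasurable)
    (by simpa using hF.integrable_share δ j hp)
    (continuous_shareD δ j k _).aestronglyMeasurable
    (by
      filter_upwards [hF.pos] with α hα t ht
      rw [Real.norm_eq_abs]
      refine (abs_shareD_le δ j k hα _).trans ?_
      rw [pow_one, mul_left_comm]
      refine mul_le_mul_of_nonneg_left ((share_le_exp δ j α _).trans ?_) hα.le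
      exact exp_sub_le_of_half hα (half_le_update hp j k ht))
    ((hF.integrable 1 (p j / 2) (half_pos (hp j))).const_mul _)
    (Eventually.of_forall fun α t _ => hasDerivAt_share δ j k α p t)
  simpa only [Function.update_eq_self] using this

lemma Mixing.hasDerivAt_integral_shareD {F : Measure ℝ} (hF : Mixing F) (δ : Fin J → ℝ)
    (j k : Fin J) {p : Fin J → ℝ} (hp : p ∈ PosPrices J) :
    Integrable (fun α => shareD₂ δ j k α p) F ∧
    HasDerivAt (fun t => ∫ α, shareD δ j k α (Function.update p j t) ∂F)
      (∫ α, shareD₂ δ j k α p ∂F) (p j) := by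
  have := hasDerivAt_integral_of_dominated_loc_of_deriv_le (μ := F) (x₀ := p j)
    (F := fun t α => shareD δ j k α (Function.update p j t))
    (F' := fun t α => shareD₂ δ j k α (Function.update p j t)) (s := Set.Ioi (p j / 2))
    (bound := fun α => 2 * Real.exp (δ j) * (α ^ 2 * Real.exp (-(p j / 2 * α))))
    (Ioi_mem_nhds (half_lt_self (hp j)))
    (Eventually.of_forall fun t => (continuous_shareD δ j k _).aestronglyMeasurable)
    (by simpa using (hF.hasDerivAt_integral_share δ j k hp).1)
    (continuous_shareD₂ δ j k _).aestronglyMeasurable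
    (by
      filter_upwards [hF.pos] with α hα t ht
      rw [Real.norm_eq_abs]
      refine (abs_shareD₂_le δ j k α _).trans ?_
      rw [mul_assoc, mul_left_comm (Real.exp (δ j))]
      refine mul_le_mul_of_nonneg_left (mul_le_mul_of_nonneg_left
        ((share_le_exp δ j α _).trans ?_) (sq_nonneg α)) zero_le_two
      exact exp_sub_le_of_half hα (half_le_update hp j j ht))
    ((hF.integrable 2 (p j / 2) (half_pos (hp j))).const_mul _)
    (Eventually.of_forall fun α t _ => hasDerivAt_shareD δ j k α p t)
  simpa only [Function.update_eq_self] using this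

lemma Mixing.integral_shareD_self_neg {F : Measure ℝ} (hF : Mixing F) (δ : Fin J → ℝ)
    (j : Fin J) {p : Fin J → ℝ} (hp : p ∈ PosPrices J) : ∫ α, shareD δ j j α p ∂F < 0 := by
  have := hF.integral_pos (hF.hasDerivAt_integral_share δ j j hp).1.neg
    fun α hα => neg_pos.2 (shareD_self_neg δ j hα p)
  simp only [Pi.neg_apply, integral_neg] at this
  linarith

lemma Mixing.integral_shareD_pos {F : Measure ℝ} (hF : Mixing F) (δ : Fin J → ℝ)
    {j k : Fin J} (hkj : k ≠ j) {p : Fin J → ℝ} (hp : p ∈ PosPrices J) :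
    0 < ∫ α, shareD δ j k α p ∂F :=
  hF.integral_pos (hF.hasDerivAt_integral_share δ j k hp).1 fun _ hα => shareD_pos δ hkj hα p

lemma Mixing.integral_shareD_ne_zero {F : Measure ℝ} (hF : Mixing F) (δ : Fin J → ℝ)
    (j k : Fin J) {p : Fin J → ℝ} (hp : p ∈ PosPrices J) : ∫ α, shareD δ j k α p ∂F ≠ 0 := by
  by_cases h : k = j
  · subst h; exact (hF.integral_shareD_self_neg δ k hp).ne
  · exact (hF.integral_shareD_pos δ h hp).ne'

lemma Mixing.integral_share_pos {F : Measure ℝ} (hF : Mixing F) (δ : Fin J → ℝ) (j : Fin J)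
    {p : Fin J → ℝ} (hp : p ∈ PosPrices J) : 0 < ∫ α, share δ j α p ∂F :=
  hF.integral_pos (hF.integrable_share δ j hp) fun α _ => share_pos δ j α p

lemma Mixing.hasDerivAt_demand {F : Measure ℝ} (hF : Mixing F) (M : ℝ) (δ : Fin J → ℝ)
    (j k : Fin J) {p : Fin J → ℝ} (hp : p ∈ PosPrices J) :
    HasDerivAt (fun t => demand M δ F j (Function.update p k t))
      (M * ∫ α, shareD δ j k α p ∂F) (p k) :=
  (hF.hasDerivAt_integral_share δ j k hp).2.const_mul M

lemma Mixing.pderiv_demand {F : Measure ℝ} (hF : Mixing F) (M : ℝ) (δ : Fin J → ℝ)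
    (j k : Fin J) {p : Fin J → ℝ} (hp : p ∈ PosPrices J) :
    pderiv k (demand M δ F j) p = M * ∫ α, shareD δ j k α p ∂F :=
  (hF.hasDerivAt_demand M δ j k hp).deriv

lemma Mixing.hasDerivAt_pderiv_demand {F : Measure ℝ} (hF : Mixing F) (M : ℝ) (δ : Fin J → ℝ)
    (j k : Fin J) {p : Fin J → ℝ} (hp : p ∈ PosPrices J) :
    HasDerivAt (fun t => pderiv k (demand M δ F j) (Function.update p j t))
      (M * ∫ α, shareD₂ δ j k α p ∂F) (p j) := by
  -- The integral formula for the inner derivative holds only at positive prices, hence only for `t`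
  -- near `p j`.
  refine ((hF.hasDerivAt_integral_shareD δ j k hp).2.const_mul M).congr_of_eventuallyEq ?_
  filter_upwards [Ioi_mem_nhds (hp j)] with t ht
  exact hF.pderiv_demand M δ j k (update_mem_posPrices hp j ht)

lemma Mixing.pderiv_pderiv_demand {F : Measure ℝ} (hF : Mixing F) (M : ℝ) (δ : Fin J → ℝ)
    (j k : Fin J) {p : Fin J → ℝ} (hp : p ∈ PosPrices J) :
    pderiv j (pderiv k (demand M δ F j)) p = M * ∫ α, shareD₂ δ j k α p ∂F :=
  (hF.hasDerivAt_pderiv_demand M δ j k hp).deriv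

lemma Mixing.regular {F : Measure ℝ} (hF : Mixing F) {M : ℝ} (hM : 0 < M) (δ : Fin J → ℝ) :
    Regular (demand M δ F) := fun p hp j k =>
  ⟨(hF.hasDerivAt_demand M δ j k hp).differentiableAt,
    (hF.hasDerivAt_pderiv_demand M δ j k hp).differentiableAt, by
    rw [hF.pderiv_demand M δ j k hp]
    exact mul_ne_zero hM.ne' (hF.integral_shareD_ne_zero δ j k hp)⟩

/-- Along a ray the diagonal term only depends on the rescaled mixing functional `N`. -/
lemma Mixing.diagTerm_smul {F : Measure ℝ} (hF : Mixing F) {M : ℝ} (hM : 0 < M)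
    (δ : Fin J → ℝ) (j : Fin J) {p : Fin J → ℝ} (hp : p ∈ PosPrices J) {x c : ℝ} (hx : 0 < x)
    (hc : c ≠ 0) (N : (ℝ → ℝ) → ℝ) (hN : ∀ g : ℝ → ℝ, ∫ α, g (x * α) ∂F = c * N g) :
    diagTerm (demand M δ F) j (x • p) =
      -2 + N (fun α => share δ j α p) * N (fun α => shareD₂ δ j j α p) /
        (N (fun α => shareD δ j j α p)) ^ 2 := by
  have hxp := smul_mem_posPrices hp hx
  have h1 := hF.integral_shareD_ne_zero δ j j hxp
  rw [diagTerm, curvature, hF.pderiv_demand M δ j j hxp, hF.pderiv_pderiv_demand M δ j j hxp,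
    demand]
  simp only [shareD_smul δ j j _ hx] at h1 ⊢
  simp only [share_smul, shareD₂_smul δ j j _ hx, integral_const_mul] at h1 ⊢
  rw [hN (fun α => shareD δ j j α p)] at h1 ⊢
  rw [hN (fun α => share δ j α p), hN (fun α => shareD₂ δ j j α p)]
  -- The value of `N` at the own derivative is nonzero because the integral it rescales is; no
  -- positivity of `N` itself is needed.
  have h2 := right_ne_zero_of_mul (right_ne_zero_of_mul h1)
  field_simp

/-- Along a ray the off-diagonal term only depends on the rescaled mixing functional `N`. -/
lemma Mixing.offDiagTerm_smul {F : Measure ℝ} (hF : Mixing F) {M : ℝ} (hM : 0 < M)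
    (δ : Fin J → ℝ) (j k : Fin J) {p : Fin J → ℝ} (hp : p ∈ PosPrices J) {x c : ℝ} (hx : 0 < x)
    (hc : c ≠ 0) (N : (ℝ → ℝ) → ℝ) (hN : ∀ g : ℝ → ℝ, ∫ α, g (x * α) ∂F = c * N g) :
    offDiagTerm (demand M δ F) j k (x • p) =
      (N (fun α => share δ j α p) * N (fun α => shareD₂ δ j k α p) -
        N (fun α => shareD δ j k α p) * N (fun α => shareD δ j j α p)) /
        (N (fun α => shareD δ j j α p)) ^ 2 := by
  have hxp := smul_mem_posPrices hp hx
  have h1 := hF.integral_shareD_ne_zero δ j j hxp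
  have h1' := hF.integral_shareD_ne_zero δ j k hxp
  rw [offDiagTerm, diversion, curvature, hF.pderiv_demand M δ j j hxp,
    hF.pderiv_demand M δ j k hxp, hF.pderiv_pderiv_demand M δ j k hxp, demand]
  simp only [shareD_smul δ j _ _ hx] at h1 h1' ⊢
  simp only [share_smul, shareD₂_smul δ j k _ hx, integral_const_mul] at h1 h1' ⊢
  rw [hN (fun α => shareD δ j j α p)] at h1 ⊢
  rw [hN (fun α => shareD δ j k α p)] at h1' ⊢
  rw [hN (fun α => share δ j α p), hN (fun α => shareD₂ δ j k α p)]
  have h2 := right_ne_zero_of_mul (right_ne_zero_of_mul h1)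
  have h2' := right_ne_zero_of_mul (right_ne_zero_of_mul h1')
  field_simp
  ring

/-! ### Exponential tilting -/

/-- Under exponential tilting with `a → ∞`, averages against a positive weight `G` converge to the
limit of the integrand at `+∞`. -/
lemma tendsto_tilted_average {G f : ℝ → ℝ} {L : ℝ} (hG : ∀ y, 0 < G y)
    (hGi : ∀ a : ℝ, Integrable (fun y => Real.exp (a * y) * G y))
    (hfi : ∀ a : ℝ, Integrable (fun y => Real.exp (a * y) * (G y * f y)))
    (hf : Tendsto f atTop (𝓝 L)) :
    Tendsto (fun a : ℝ => (∫ y, Real.exp (a * y) * (G y * f y)) / ∫ y, Real.exp (a * y) * G y)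
      atTop (𝓝 L) := by
  have hpos : ∀ a : ℝ, 0 < ∫ y, Real.exp (a * y) * G y := fun a => by
    rw [integral_pos_iff_support_of_nonneg
      (fun y => (mul_pos (Real.exp_pos _) (hG y)).le) (hGi a)]
    rw [Set.eq_univ_of_forall (s := Function.support fun y => Real.exp (a * y) * G y)
      (fun y => (mul_pos (Real.exp_pos _) (hG y)).ne')]
    simp
  have hdi : ∀ a : ℝ, Integrable (fun y => Real.exp (a * y) * (G y * (f y - L))) := fun a => by
    refine ((hfi a).sub ((hGi a).mul_const L)).congr (ae_of_all _ fun y => ?_)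
    simp only [Pi.sub_apply]; ring
  suffices h : Tendsto (fun a : ℝ => (∫ y, Real.exp (a * y) * (G y * (f y - L))) /
      ∫ y, Real.exp (a * y) * G y) atTop (𝓝 0) by
    have h' := h.add_const L
    rw [zero_add] at h'
    refine h'.congr fun a => ?_
    rw [div_add' _ _ _ (hpos a).ne']
    congr 1
    rw [mul_comm L, ← integral_mul_const, ← integral_add (hdi a) ((hGi a).mul_const L)]
    congr 1; ext y; ring
  rw [Metric.tendsto_atTop]
  intro ε hε
  obtain ⟨K, hK⟩ := (Metric.tendsto_atTop.1 hf) (ε / 2) (half_pos hε)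
  -- Beyond `K` the integrand is within `ε / 2` of its limit. The part below `K` contributes at most
  -- `e^{aK} A`, while the mass beyond `K + 1` is at least `e^{a(K+1)} B`; the unit gap makes the
  -- ratio `(A / B) e^{-a}`.
  set A := ∫ y in Set.Iic K, |G y * (f y - L)| with hA
  set B := ∫ y in Set.Ioi (K + 1), G y with hB
  have hGint : Integrable G := by simpa using hGi 0
  have hDint : Integrable (fun y => G y * (f y - L)) := by simpa using hdi 0
  have hBpos : 0 < B := by
    rw [hB, integral_pos_iff_support_of_nonneg (fun y => (hG y).le) hGint.integrableOn]
    rw [Set.eq_univ_of_forall (s := Function.support G) (fun y => (hG y).ne')]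
    simp
  have hA0 : 0 ≤ A := integral_nonneg fun y => abs_nonneg _
  have hlow : ∀ a : ℝ, 0 ≤ a → Real.exp (a * (K + 1)) * B ≤ ∫ y, Real.exp (a * y) * G y := by
    intro a ha
    calc Real.exp (a * (K + 1)) * B = ∫ y in Set.Ioi (K + 1), Real.exp (a * (K + 1)) * G y := by
          rw [integral_const_mul]
      _ ≤ ∫ y in Set.Ioi (K + 1), Real.exp (a * y) * G y := by
          refine setIntegral_mono_on (hGint.integrableOn.const_mul _) (hGi a).integrableOn
            measurableSet_Ioi fun y hy => ?_
          exact mul_le_mul_of_nonneg_right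
            (Real.exp_le_exp.2 (mul_le_mul_of_nonneg_left (le_of_lt hy) ha)) (hG y).le
      _ ≤ _ := setIntegral_le_integral (hGi a)
          (ae_of_all _ fun y => (mul_pos (Real.exp_pos _) (hG y)).le)
  have hup : ∀ a : ℝ, 0 ≤ a → |∫ y, Real.exp (a * y) * (G y * (f y - L))| ≤
      Real.exp (a * K) * A + ε / 2 * ∫ y, Real.exp (a * y) * G y := by
    intro a ha
    have hcompl : (Set.Iic K)ᶜ = Set.Ioi K := Set.compl_Iic
    calc |∫ y, Real.exp (a * y) * (G y * (f y - L))|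
        ≤ ∫ y, |Real.exp (a * y) * (G y * (f y - L))| := abs_integral_le_integral_abs
      _ = (∫ y in Set.Iic K, |Real.exp (a * y) * (G y * (f y - L))|) +
          ∫ y in Set.Ioi K, |Real.exp (a * y) * (G y * (f y - L))| := by
          rw [← hcompl, integral_add_compl measurableSet_Iic (hdi a).abs]
      _ ≤ (∫ y in Set.Iic K, Real.exp (a * K) * |G y * (f y - L)|) +
          ∫ y in Set.Ioi K, ε / 2 * (Real.exp (a * y) * G y) := by
          refine add_le_add ?_ ?_
          · refine setIntegral_mono_on (hdi a).abs.integrableOn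
              (hDint.abs.integrableOn.const_mul _) measurableSet_Iic fun y hy => ?_
            rw [abs_mul, abs_of_pos (Real.exp_pos _)]
            exact mul_le_mul_of_nonneg_right
              (Real.exp_le_exp.2 (mul_le_mul_of_nonneg_left hy ha)) (abs_nonneg _)
          · refine setIntegral_mono_on (hdi a).abs.integrableOn
              ((hGi a).integrableOn.const_mul _) measurableSet_Ioi fun y hy => ?_
            rw [abs_mul, abs_of_pos (Real.exp_pos _), abs_mul, abs_of_pos (hG y)]
            have := hK y (le_of_lt hy)
            rw [Real.dist_eq] at this
            have h3 := mul_pos (Real.exp_pos (a * y)) (hG y)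
            nlinarith
      _ ≤ _ := by
          rw [integral_const_mul, integral_const_mul]
          refine add_le_add le_rfl (mul_le_mul_of_nonneg_left ?_ (half_pos hε).le)
          exact setIntegral_le_integral (hGi a)
            (ae_of_all _ fun y => (mul_pos (Real.exp_pos _) (hG y)).le)
  have hsmall : Tendsto (fun a : ℝ => A / B * Real.exp (-a)) atTop (𝓝 0) := by
    simpa using (Real.tendsto_exp_neg_atTop_nhds_zero).const_mul (A / B)
  obtain ⟨N, hN⟩ := eventually_atTop.1
    ((hsmall.eventually (gt_mem_nhds (half_pos hε))).and (eventually_ge_atTop 0))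
  refine ⟨N, fun a haN => ?_⟩
  obtain ⟨h1, h2⟩ := hN a haN
  rw [Real.dist_eq, sub_zero, abs_div, abs_of_pos (hpos a), div_lt_iff₀ (hpos a)]
  have h3 : Real.exp (a * K) * A < ε / 2 * ∫ y, Real.exp (a * y) * G y := by
    calc Real.exp (a * K) * A = (A / B * Real.exp (-a)) * (Real.exp (a * (K + 1)) * B) := by
          rw [show a * (K + 1) = a * K + a by ring, Real.exp_add, Real.exp_neg]
          field_simp
      _ < ε / 2 * (Real.exp (a * (K + 1)) * B) := by gcongr
      _ ≤ _ := by
          have := hlow a h2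
          gcongr
  linarith [hup a h2]

lemma integrable_exp_mul_gaussian_weight {b : ℝ} (hb : 0 < b) (a : ℝ) :
    Integrable (fun y : ℝ => Real.exp (a * y) * Real.exp (-(b * y ^ 2))) := by
  have := (integrable_cexp_quadratic (b := (b : ℂ)) (by simpa using hb) (a : ℂ) 0).re
  refine this.congr (ae_of_all _ fun y => ?_)
  simp only [add_zero, ← Real.exp_add]
  have : (-(b : ℂ) * (y : ℂ) ^ 2 + (a : ℂ) * (y : ℂ)) = ((a * y + -(b * y ^ 2) : ℝ) : ℂ) := by
    push_cast; ring
  rw [this]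
  exact Complex.exp_ofReal_re _

/-! ### Log-normal mixing -/

lemma logNormal_eq_map (μ σ : ℝ) :
    logNormal μ σ = (gaussianReal μ (Real.toNNReal (σ ^ 2))).map Real.exp := by
  rw [Real.toNNReal_of_nonneg (sq_nonneg σ)]
  rfl

lemma mixing_logNormal (μ : ℝ) {σ : ℝ} : Mixing (logNormal μ σ) := by
  rw [logNormal_eq_map]
  have hm : IsProbabilityMeasure ((gaussianReal μ (Real.toNNReal (σ ^ 2))).map Real.exp) :=
    Measure.isProbabilityMeasure_map Real.measurable_exp.aemeasurable
  refine Mixing.of_finite ?_ (IsProbabilityMeasure.ne_zero _)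
  rw [ae_map_iff Real.measurable_exp.aemeasurable measurableSet_Ioi]
  exact ae_of_all _ fun y => Real.exp_pos y

/-- Completing the square after translating the Gaussian by `log x`: the cross term is the tilt, and
the term free of `y` goes into the constant. -/
lemma integral_logNormal_mul (μ : ℝ) {σ x : ℝ} (hσ : 0 < σ) (hx : 0 < x) (g : ℝ → ℝ) :
    ∫ α, g (x * α) ∂(logNormal μ σ) =
      ((Real.sqrt (2 * Real.pi * σ ^ 2))⁻¹ *
        Real.exp (-((Real.log x + μ) ^ 2 / (2 * σ ^ 2)))) *
      ∫ y, g (Real.exp y) * (Real.exp ((Real.log x + μ) / σ ^ 2 * y) *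
        Real.exp (-(1 / (2 * σ ^ 2) * y ^ 2))) := by
  have hv : Real.toNNReal (σ ^ 2) ≠ 0 := (Real.toNNReal_pos.2 (by positivity)).ne'
  rw [logNormal_eq_map, Real.isOpenEmbedding_exp.measurableEmbedding.integral_map,
    integral_gaussianReal_eq_integral_smul hv,
    ← integral_sub_right_eq_self _ (Real.log x), ← integral_const_mul]
  congr 1
  ext y
  rw [Real.exp_sub, Real.exp_log hx, mul_div_cancel₀ _ hx.ne', smul_eq_mul, gaussianPDFReal]
  rw [Real.coe_toNNReal _ (sq_nonneg σ)]
  rw [mul_comm (g _), mul_assoc, mul_assoc, mul_assoc]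
  congr 1
  rw [← mul_assoc, ← mul_assoc, ← Real.exp_add, ← Real.exp_add]
  congr 2
  field_simp
  ring

lemma tendsto_share_atTop (δ : Fin J → ℝ) (j : Fin J) {p : Fin J → ℝ} (hp : p ∈ PosPrices J) :
    Tendsto (fun α => share δ j α p) atTop (𝓝 0) := by
  refine squeeze_zero (fun α => (share_pos δ j α p).le) (fun α => share_le_exp δ j α p) ?_
  refine Real.tendsto_exp_atBot.comp ?_
  exact tendsto_atBot_add_const_left _ (δ j)
    (tendsto_neg_atTop_atBot.comp (tendsto_id.atTop_mul_const (hp j)))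

/-- The logarithmic derivative in the coefficient is the share-weighted sum of prices minus the own
price; as the shares vanish it tends to `-p j`, which is the source of the limit in
`tendsto_tiltedMass_ratio`. -/
lemma hasDerivAt_share_coeff (δ : Fin J → ℝ) (j : Fin J) (p : Fin J → ℝ) (α : ℝ) :
    HasDerivAt (fun α => share δ j α p)
      (share δ j α p * (∑ l, p l * share δ l α p - p j)) α := by
  have hexp : ∀ l : Fin J, HasDerivAt (fun α => Real.exp (δ l - α * p l))
      (-(p l * Real.exp (δ l - α * p l))) α := by
    intro l
    have := (((hasDerivAt_id α).mul_const (p l)).const_sub (δ l)).exp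
    simp only [id, one_mul] at this
    convert this using 1; ring
  have hsum := (HasDerivAt.fun_sum (u := Finset.univ) fun l _ => hexp l).const_add 1
  have hd := logit_denom_pos δ α p
  refine ((hexp j).div hsum hd.ne').congr_deriv ?_
  simp only [share, ← mul_div_assoc, ← Finset.sum_div, Finset.sum_neg_distrib]
  field_simp
  ring

/-- The density in `y = log α`, up to tilting, of demand under log-normal mixing. -/
noncomputable def logNormalWeight (δ : Fin J → ℝ) (σ : ℝ) (j : Fin J) (p : Fin J → ℝ) (y : ℝ) : ℝ :=
  Real.exp (-(1 / (2 * σ ^ 2) * y ^ 2)) * share δ j (Real.exp y) p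

section LogNormal

variable (δ : Fin J → ℝ) {σ : ℝ} (hσ : 0 < σ) (j : Fin J) {p : Fin J → ℝ}

lemma logNormalWeight_pos (σ : ℝ) (p : Fin J → ℝ) (y : ℝ) : 0 < logNormalWeight δ σ j p y :=
  mul_pos (Real.exp_pos _) (share_pos δ j _ p)

lemma continuous_logNormalWeight (σ : ℝ) (p : Fin J → ℝ) :
    Continuous (logNormalWeight δ σ j p) := by
  have := (continuous_share δ j p).comp Real.continuous_exp
  unfold logNormalWeight
  exact Continuous.mul (by fun_prop) this

include hσ in
lemma integrable_exp_mul_logNormalWeight (p : Fin J → ℝ) (a : ℝ) :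
    Integrable (fun y => Real.exp (a * y) * logNormalWeight δ σ j p y) := by
  have hc := continuous_logNormalWeight δ j σ p
  refine (integrable_exp_mul_gaussian_weight (b := 1 / (2 * σ ^ 2)) (by positivity) a).mono'
    (by fun_prop) (ae_of_all _ fun y => ?_)
  rw [Real.norm_eq_abs, abs_of_pos (mul_pos (Real.exp_pos _) (logNormalWeight_pos δ j σ p y))]
  refine mul_le_mul_of_nonneg_left ?_ (Real.exp_pos _).le
  exact mul_le_of_le_one_right (Real.exp_pos _).le (share_lt_one δ j _ p).le

include hσ in
lemma integrable_exp_mul_logNormalWeight_mul (p : Fin J → ℝ) {f : ℝ → ℝ} (hf : Continuous f)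
    {C : ℝ} (hC : ∀ y, |f y| ≤ C) (a : ℝ) :
    Integrable (fun y => Real.exp (a * y) * (logNormalWeight δ σ j p y * f y)) := by
  refine ((integrable_exp_mul_logNormalWeight δ hσ j p a).mul_bdd (c := C)
    hf.aestronglyMeasurable (ae_of_all _ hC)).congr (ae_of_all _ fun y => ?_)
  simp only; ring

/-- The tilted total mass `∫ e^{ay} G(y) dy` of the log-normal weight. -/
noncomputable def tiltedMass (δ : Fin J → ℝ) (σ : ℝ) (j : Fin J) (p : Fin J → ℝ) (a : ℝ) : ℝ :=
  ∫ y, Real.exp (a * y) * logNormalWeight δ σ j p y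

include hσ in
lemma tiltedMass_pos (p : Fin J → ℝ) (a : ℝ) : 0 < tiltedMass δ σ j p a := by
  have h : ∀ y, 0 < Real.exp (a * y) * logNormalWeight δ σ j p y :=
    fun y => mul_pos (Real.exp_pos _) (logNormalWeight_pos δ j σ p y)
  rw [tiltedMass, integral_pos_iff_support_of_nonneg (fun y => (h y).le)
    (integrable_exp_mul_logNormalWeight δ hσ j p a),
    Set.eq_univ_of_forall (s := Function.support _) (fun y => (h y).ne')]
  simp

include hσ in
lemma tendsto_average_logNormalWeight (p : Fin J → ℝ) {f : ℝ → ℝ} (hf : Continuous f)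
    {C L : ℝ} (hC : ∀ y, |f y| ≤ C) (hL : Tendsto f atTop (𝓝 L)) :
    Tendsto (fun a : ℝ => (∫ y, Real.exp (a * y) * (logNormalWeight δ σ j p y * f y)) /
      tiltedMass δ σ j p a) atTop (𝓝 L) :=
  tendsto_tilted_average (logNormalWeight_pos δ j σ p)
    (integrable_exp_mul_logNormalWeight δ hσ j p)
    (integrable_exp_mul_logNormalWeight_mul δ hσ j p hf hC) hL

-- Integrating the derivative of `e^{ay} G(y)` over the line gives 0, so `a T(a) = ∫ e^{(a+1)y} G f`
-- with `f` equal to `-e^{-y}` times the logarithmic derivative of `G`. Since `f → p j` at `+∞`, the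
-- tilted average at `a + 1` yields the limit.
include hσ in
lemma tendsto_tiltedMass_ratio (hp : p ∈ PosPrices J) :
    Tendsto (fun a : ℝ => a * tiltedMass δ σ j p a / tiltedMass δ σ j p (a + 1)) atTop
      (𝓝 (p j)) := by
  set G := logNormalWeight δ σ j p with hG
  have hGc : Continuous G := continuous_logNormalWeight δ j σ p
  have hGi := integrable_exp_mul_logNormalWeight δ hσ j p
  set S : ℝ → ℝ := fun y => ∑ l, p l * share δ l (Real.exp y) p with hS
  have hSc : Continuous S := continuous_finsetSum _ fun l _ =>
    continuous_const.mul ((continuous_share δ l p).comp Real.continuous_exp)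
  have hS0 : Tendsto S atTop (𝓝 0) := by
    have : Tendsto S atTop (𝓝 (∑ l, p l * 0)) := tendsto_finsetSum _ fun l _ =>
      ((tendsto_share_atTop δ l hp).comp Real.tendsto_exp_atTop).const_mul _
    simpa using this
  have hSb : ∀ y, |S y| ≤ ∑ l, p l := fun y => by
    rw [abs_of_nonneg (Finset.sum_nonneg fun l _ => mul_nonneg (hp l).le (share_pos δ l _ p).le)]
    exact Finset.sum_le_sum fun l _ => mul_le_of_le_one_right (hp l).le (share_lt_one δ l _ p).le
  set f : ℝ → ℝ := fun y => 1 / σ ^ 2 * (y * Real.exp (-y)) + (p j - S y) with hf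
  have hfL : Tendsto f atTop (𝓝 (p j)) := by
    have h1 : Tendsto (fun y : ℝ => y * Real.exp (-y)) atTop (𝓝 0) := by
      simpa using Real.tendsto_pow_mul_exp_neg_atTop_nhds_zero 1
    have := (h1.const_mul (1 / σ ^ 2)).add (hS0.const_sub (p j))
    rwa [mul_zero, zero_add, sub_zero] at this
  -- The function `f` is unbounded at `-∞`, so the bounded-factor lemma does not apply; `|y| ≤ e^y +
  -- e^{-y}` bounds this piece by the weights tilted by `a` and `a - 2`.
  have hyi : ∀ a : ℝ, Integrable (fun y => Real.exp (a * y) * (G y * (y * Real.exp (-y)))) := by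
    intro a
    refine ((hGi a).add (hGi (a - 2))).mono' (by fun_prop) (ae_of_all _ fun y => ?_)
    have hy : |y| ≤ Real.exp y + Real.exp (-y) := by
      rw [abs_le]
      constructor <;> linarith [Real.add_one_le_exp y, Real.add_one_le_exp (-y),
        Real.exp_pos y, Real.exp_pos (-y)]
    rw [Real.norm_eq_abs, abs_mul, abs_mul, abs_mul, abs_of_pos (Real.exp_pos _),
      abs_of_pos (Real.exp_pos _), abs_of_pos (logNormalWeight_pos δ j σ p y)]
    calc Real.exp (a * y) * (G y * (|y| * Real.exp (-y)))
        ≤ Real.exp (a * y) * (G y * ((Real.exp y + Real.exp (-y)) * Real.exp (-y))) := by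
          have := logNormalWeight_pos δ j σ p y
          gcongr
      _ = _ := by
          have e1 : Real.exp y * Real.exp (-y) = 1 := by rw [← Real.exp_add]; simp
          have e2 : Real.exp ((a - 2) * y) = Real.exp (a * y) * (Real.exp (-y) * Real.exp (-y)) := by
            rw [← Real.exp_add, ← Real.exp_add]; congr 1; ring
          simp only [Pi.add_apply]
          rw [e2, add_mul, e1]; ring
  have hfi : ∀ a : ℝ, Integrable (fun y => Real.exp (a * y) * (G y * f y)) := by
    intro a
    have h2 := integrable_exp_mul_logNormalWeight_mul δ hσ j p (f := fun y => p j - S y)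
      (by fun_prop) (C := |p j| + ∑ l, p l)
      (fun y => (abs_sub _ _).trans (add_le_add le_rfl (hSb y))) a
    refine (((hyi a).const_mul (1 / σ ^ 2)).add h2).congr (ae_of_all _ fun y => ?_)
    simp only [Pi.add_apply, hf]; ring
  have hlim := (tendsto_tilted_average (logNormalWeight_pos δ j σ p) hGi hfi hfL).comp
    (tendsto_atTop_add_const_right atTop (1 : ℝ) tendsto_id)
  refine hlim.congr fun a => ?_
  simp only [Function.comp, id, tiltedMass]
  congr 1
  have hderiv : ∀ y, HasDerivAt (fun y => Real.exp (a * y) * G y)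
      (a * (Real.exp (a * y) * G y) - Real.exp ((a + 1) * y) * (G y * f y)) y := by
    intro y
    have h1 : HasDerivAt (fun y => Real.exp (a * y)) (Real.exp (a * y) * a) y := by
      simpa using ((hasDerivAt_id y).const_mul a).exp
    have h2 : HasDerivAt (fun y : ℝ => Real.exp (-(1 / (2 * σ ^ 2) * y ^ 2)))
        (Real.exp (-(1 / (2 * σ ^ 2) * y ^ 2)) * (-(y / σ ^ 2))) y := by
      have := (((hasDerivAt_id y).pow 2).const_mul (1 / (2 * σ ^ 2))).fun_neg.exp
      refine this.congr_deriv ?_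
      simp only [id, Pi.pow_apply, Nat.cast_ofNat]
      congr 1
      field_simp
      norm_num
    have h3 := (hasDerivAt_share_coeff δ j p (Real.exp y)).comp y (Real.hasDerivAt_exp y)
    refine (h1.mul (h2.mul h3)).congr_deriv ?_
    have e1 : Real.exp ((a + 1) * y) = Real.exp (a * y) * Real.exp y := by
      rw [← Real.exp_add]; congr 1; ring
    have e2 : Real.exp (-y) = (Real.exp y)⁻¹ := Real.exp_neg y
    simp only [hf, hS, hG, logNormalWeight, Pi.mul_apply, Function.comp]
    rw [e1, e2]
    have := Real.exp_pos y
    field_simp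
    ring
  have hz := integral_eq_zero_of_hasDerivAt_of_integrable hderiv
    (((hGi a).const_mul a).sub (hfi (a + 1))) (hGi a)
  rw [integral_sub ((hGi a).const_mul a) (hfi (a + 1)), integral_const_mul] at hz
  linarith

-- Divide the limit of `a T(a) / T(a+1)` by the same limit shifted by one; the leftover factor `a /
-- (a + 1)` is removed by `1 + 1 / a`.
include hσ in
lemma tendsto_tiltedMass_curvature (hp : p ∈ PosPrices J) :
    Tendsto (fun a : ℝ => tiltedMass δ σ j p a * tiltedMass δ σ j p (a + 2) /
      tiltedMass δ σ j p (a + 1) ^ 2) atTop (𝓝 1) := by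
  have h1 := tendsto_tiltedMass_ratio δ hσ j hp
  have h2 := h1.comp (tendsto_atTop_add_const_right atTop (1 : ℝ) tendsto_id)
  have h3 : Tendsto (fun a : ℝ => 1 + a⁻¹) atTop (𝓝 (1 + 0)) :=
    tendsto_inv_atTop_zero.const_add 1
  have h4 := (h1.div h2 (hp j).ne').mul h3
  rw [div_self (hp j).ne', add_zero, one_mul] at h4
  refine h4.congr' ?_
  filter_upwards [eventually_gt_atTop 0] with a ha
  simp only [Function.comp, id, Pi.div_apply]
  rw [show a + 1 + 1 = a + 2 by ring]
  have e0 := tiltedMass_pos δ hσ j p a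
  have e1 := tiltedMass_pos δ hσ j p (a + 1)
  have e2 := tiltedMass_pos δ hσ j p (a + 2)
  field_simp

end LogNormal

/-- The derivative's factor `α = e^y` raises the tilt by one, leaving a bounded function of the
shares against the weight. -/
lemma integral_shareD_logNormal (δ : Fin J → ℝ) (σ : ℝ) (j k : Fin J) (p : Fin J → ℝ) (a : ℝ) :
    ∫ y, shareD δ j k (Real.exp y) p * (Real.exp (a * y) *
        Real.exp (-(1 / (2 * σ ^ 2) * y ^ 2))) =
      ∫ y, Real.exp ((a + 1) * y) * (logNormalWeight δ σ j p y *
        (share δ k (Real.exp y) p - if k = j then 1 else 0)) := by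
  congr 1; ext y
  rw [show (a + 1) * y = a * y + y by ring, Real.exp_add, shareD, logNormalWeight]
  ring

lemma integral_shareD₂_logNormal (δ : Fin J → ℝ) (σ : ℝ) (j k : Fin J) (p : Fin J → ℝ) (a : ℝ) :
    ∫ y, shareD₂ δ j k (Real.exp y) p * (Real.exp (a * y) *
        Real.exp (-(1 / (2 * σ ^ 2) * y ^ 2))) =
      ∫ y, Real.exp ((a + 2) * y) * (logNormalWeight δ σ j p y *
        ((share δ j (Real.exp y) p - 1) * (share δ k (Real.exp y) p - if k = j then 1 else 0) +
          share δ k (Real.exp y) p * (share δ j (Real.exp y) p - if k = j then 1 else 0))) := by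
  congr 1; ext y
  rw [show (a + 2) * y = a * y + (y + y) by ring, Real.exp_add, Real.exp_add, shareD₂,
    logNormalWeight]
  ring

lemma integral_share_logNormal (δ : Fin J → ℝ) (σ : ℝ) (j : Fin J) (p : Fin J → ℝ) (a : ℝ) :
    ∫ y, share δ j (Real.exp y) p * (Real.exp (a * y) *
        Real.exp (-(1 / (2 * σ ^ 2) * y ^ 2))) = tiltedMass δ σ j p a := by
  rw [tiltedMass]
  congr 1; ext y
  rw [logNormalWeight]
  ring

lemma tendsto_integral_shareD_logNormal (δ : Fin J → ℝ) {σ : ℝ} (hσ : 0 < σ) (j k : Fin J)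
    {p : Fin J → ℝ} (hp : p ∈ PosPrices J) :
    Tendsto (fun a : ℝ => (∫ y, shareD δ j k (Real.exp y) p * (Real.exp (a * y) *
        Real.exp (-(1 / (2 * σ ^ 2) * y ^ 2)))) / tiltedMass δ σ j p (a + 1)) atTop
      (𝓝 (-if k = j then 1 else 0)) := by
  have hc := (continuous_share δ k p).comp Real.continuous_exp
  have hL := ((tendsto_share_atTop δ k hp).comp Real.tendsto_exp_atTop).sub_const
    (if k = j then (1 : ℝ) else 0)
  have := tendsto_average_logNormalWeight δ hσ j p (hc.sub continuous_const)
    (fun y => abs_share_sub_le δ j k k (Real.exp y) p) hL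
  rw [zero_sub] at this
  refine (this.comp (tendsto_atTop_add_const_right atTop (1 : ℝ) tendsto_id)).congr fun a => ?_
  rw [integral_shareD_logNormal]
  rfl

lemma tendsto_integral_shareD₂_logNormal (δ : Fin J → ℝ) {σ : ℝ} (hσ : 0 < σ) (j k : Fin J)
    {p : Fin J → ℝ} (hp : p ∈ PosPrices J) :
    Tendsto (fun a : ℝ => (∫ y, shareD₂ δ j k (Real.exp y) p * (Real.exp (a * y) *
        Real.exp (-(1 / (2 * σ ^ 2) * y ^ 2)))) / tiltedMass δ σ j p (a + 2)) atTop
      (𝓝 (if k = j then 1 else 0)) := by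
  have hcj := (continuous_share δ j p).comp Real.continuous_exp
  have hck := (continuous_share δ k p).comp Real.continuous_exp
  have hj := (tendsto_share_atTop δ j hp).comp Real.tendsto_exp_atTop
  have hk := (tendsto_share_atTop δ k hp).comp Real.tendsto_exp_atTop
  have hL := ((hj.sub_const 1).mul (hk.sub_const (if k = j then (1 : ℝ) else 0))).add
    (hk.mul (hj.sub_const (if k = j then (1 : ℝ) else 0)))
  have hb : ∀ y, |(share δ j (Real.exp y) p - 1) *
      (share δ k (Real.exp y) p - if k = j then 1 else 0) +
      share δ k (Real.exp y) p * (share δ j (Real.exp y) p - if k = j then 1 else 0)| ≤ 2 := by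
    -- The bound on `shareD₂` already contains this one, after cancelling the positive factor `α ^
    -- 2` times the share.
    intro y
    have h := abs_shareD₂_le δ j k (Real.exp y) p
    have hs := share_pos δ j (Real.exp y) p
    have he := Real.exp_pos y
    rw [shareD₂, abs_mul, abs_of_pos (by positivity), abs_mul, abs_of_pos hs, ← mul_assoc,
      mul_comm 2] at h
    exact le_of_mul_le_mul_left h (by positivity)
  have := tendsto_average_logNormalWeight δ hσ j p (((hcj.sub continuous_const).mul
    (hck.sub continuous_const)).add (hck.mul (hcj.sub continuous_const))) hb hL
  rw [show ((0 : ℝ) - 1) * (0 - if k = j then 1 else 0) + 0 * (0 - if k = j then 1 else 0) =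
    if k = j then 1 else 0 by ring] at this
  refine (this.comp (tendsto_atTop_add_const_right atTop (2 : ℝ) tendsto_id)).congr fun a => ?_
  rw [integral_shareD₂_logNormal]
  rfl

/-- Here `B`, `B'` stand for the masses at tilts `a + 1`, `a + 2`, by which the first and second
derivatives were normalised; they cancel. -/
lemma mul_div_mul_div_div_div {B B' : ℝ} (A D D' : ℝ) (hB : B ≠ 0) (hB' : B' ≠ 0) :
    A * B' / B ^ 2 * (D' / B') / (D / B) ^ 2 = A * D' / D ^ 2 := by
  rw [div_pow, div_mul_div_comm, mul_comm (B ^ 2), mul_right_comm, mul_comm (A * D'),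
    mul_div_mul_left _ _ hB', div_div_div_cancel_right₀ (pow_ne_zero 2 hB)]

lemma tendsto_logNormal_tilt (μ : ℝ) {σ : ℝ} (hσ : 0 < σ) :
    Tendsto (fun x : ℝ => (Real.log x + μ) / σ ^ 2) atTop atTop :=
  (tendsto_atTop_add_const_right atTop μ Real.tendsto_log_atTop).atTop_div_const (by positivity)

lemma tendsto_diagTerm_logNormal {M : ℝ} (hM : 0 < M) (δ : Fin J → ℝ) (μ : ℝ) {σ : ℝ}
    (hσ : 0 < σ) (j : Fin J) {p : Fin J → ℝ} (hp : p ∈ PosPrices J) :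
    Tendsto (fun x : ℝ => diagTerm (demand M δ (logNormal μ σ)) j (x • p)) atTop (𝓝 (-1)) := by
  have h0 := tendsto_tiltedMass_curvature δ hσ j hp
  have h1 := tendsto_integral_shareD_logNormal δ hσ j j hp
  have h2 := tendsto_integral_shareD₂_logNormal δ hσ j j hp
  rw [if_pos rfl] at h1 h2
  have h := ((h0.mul h2).div (h1.pow 2) (by norm_num)).const_add (-2)
  rw [show (-2 : ℝ) + 1 * 1 / (-1) ^ 2 = -1 by norm_num] at h
  refine (h.comp (tendsto_logNormal_tilt μ hσ)).congr' ?_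
  filter_upwards [eventually_gt_atTop 0] with x hx
  rw [(mixing_logNormal μ).diagTerm_smul hM δ j hp hx (by positivity)
    (fun g => ∫ y, g (Real.exp y) * (Real.exp ((Real.log x + μ) / σ ^ 2 * y) *
        Real.exp (-(1 / (2 * σ ^ 2) * y ^ 2)))) (integral_logNormal_mul μ hσ hx)]
  simp only [Function.comp, Pi.div_apply, integral_share_logNormal]
  have e1 := tiltedMass_pos δ hσ j p ((Real.log x + μ) / σ ^ 2 + 1)
  have e2 := tiltedMass_pos δ hσ j p ((Real.log x + μ) / σ ^ 2 + 2)
  generalize tiltedMass δ σ j p ((Real.log x + μ) / σ ^ 2 + 1) = B at e1 ⊢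
  generalize tiltedMass δ σ j p ((Real.log x + μ) / σ ^ 2 + 2) = B' at e2 ⊢
  rw [mul_div_mul_div_div_div _ _ _ e1.ne' e2.ne']

lemma tendsto_offDiagTerm_logNormal {M : ℝ} (hM : 0 < M) (δ : Fin J → ℝ) (μ : ℝ) {σ : ℝ}
    (hσ : 0 < σ) {j k : Fin J} (hkj : k ≠ j) {p : Fin J → ℝ} (hp : p ∈ PosPrices J) :
    Tendsto (fun x : ℝ => offDiagTerm (demand M δ (logNormal μ σ)) j k (x • p)) atTop
      (𝓝 0) := by
  have h0 := tendsto_tiltedMass_curvature δ hσ j hp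
  have h1 := tendsto_integral_shareD_logNormal δ hσ j j hp
  have h1' := tendsto_integral_shareD_logNormal δ hσ j k hp
  have h2 := tendsto_integral_shareD₂_logNormal δ hσ j k hp
  rw [if_pos rfl] at h1
  rw [if_neg hkj] at h1' h2
  have h := ((h0.mul h2).sub (h1'.mul h1)).div (h1.pow 2) (by norm_num)
  rw [show ((1 : ℝ) * 0 - -0 * -1) / (-1) ^ 2 = 0 by norm_num] at h
  refine (h.comp (tendsto_logNormal_tilt μ hσ)).congr' ?_
  filter_upwards [eventually_gt_atTop 0] with x hx
  rw [(mixing_logNormal μ).offDiagTerm_smul hM δ j k hp hx (by positivity)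
    (fun g => ∫ y, g (Real.exp y) * (Real.exp ((Real.log x + μ) / σ ^ 2 * y) *
        Real.exp (-(1 / (2 * σ ^ 2) * y ^ 2)))) (integral_logNormal_mul μ hσ hx)]
  simp only [Function.comp, Pi.div_apply, integral_share_logNormal]
  have e1 := tiltedMass_pos δ hσ j p ((Real.log x + μ) / σ ^ 2 + 1)
  have e2 := tiltedMass_pos δ hσ j p ((Real.log x + μ) / σ ^ 2 + 2)
  generalize tiltedMass δ σ j p ((Real.log x + μ) / σ ^ 2 + 1) = B at e1 ⊢
  generalize tiltedMass δ σ j p ((Real.log x + μ) / σ ^ 2 + 2) = B' at e2 ⊢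
  rw [sub_div, sub_div, mul_div_mul_div_div_div _ _ _ e1.ne' e2.ne',
    div_mul_div_comm, div_pow, ← sq, div_div_div_cancel_right₀ (pow_ne_zero 2 e1.ne')]

/-! ### The limiting measure of gamma mixing -/

/-- The measure `z ^ (r - 1) dz` on the positive half-line. -/
noncomputable def powMeasure (r : ℝ) : Measure ℝ :=
  (volume.restrict (Set.Ioi 0)).withDensity fun z => ENNReal.ofReal (z ^ (r - 1))

lemma integral_powMeasure (r : ℝ) (g : ℝ → ℝ) :
    ∫ z, g z ∂(powMeasure r) = ∫ z in Set.Ioi 0, z ^ (r - 1) * g z := by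
  rw [powMeasure, integral_withDensity_eq_integral_toReal_smul (by fun_prop)
    (ae_of_all _ fun _ => ENNReal.ofReal_lt_top)]
  refine setIntegral_congr_fun measurableSet_Ioi fun z hz => ?_
  simp only [smul_eq_mul]
  rw [ENNReal.toReal_ofReal (Real.rpow_nonneg (le_of_lt hz) _)]

lemma integrable_powMeasure_iff (r : ℝ) (g : ℝ → ℝ) :
    Integrable g (powMeasure r) ↔ IntegrableOn (fun z => z ^ (r - 1) * g z) (Set.Ioi 0) := by
  rw [powMeasure, integrable_withDensity_iff_integrable_smul' (by fun_prop)
    (ae_of_all _ fun _ => ENNReal.ofReal_lt_top)]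
  refine integrableOn_congr_fun (fun z hz => ?_) measurableSet_Ioi
  simp only [smul_eq_mul]
  rw [ENNReal.toReal_ofReal (Real.rpow_nonneg (le_of_lt hz) _)]

lemma rpow_mul_pow {z : ℝ} (hz : 0 < z) (r : ℝ) (m : ℕ) :
    z ^ (r - 1) * z ^ m = z ^ (r + m - 1) := by
  rw [← Real.rpow_natCast z m, ← Real.rpow_add hz]
  congr 1; ring

lemma integral_powMeasure_pow_mul_exp {r : ℝ} (hr : 0 < r) (m : ℕ) {c : ℝ} (hc : 0 < c) :
    ∫ z, z ^ m * Real.exp (-(c * z)) ∂(powMeasure r) =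
      (1 / c) ^ (r + m) * Real.Gamma (r + m) := by
  rw [integral_powMeasure, ← Real.integral_rpow_mul_exp_neg_mul_Ioi (by positivity) hc]
  refine setIntegral_congr_fun measurableSet_Ioi fun z hz => ?_
  rw [← mul_assoc, rpow_mul_pow hz]

lemma mixing_powMeasure {r : ℝ} (hr : 0 < r) : Mixing (powMeasure r) where
  pos := (withDensity_absolutelyContinuous _ _).ae_le (ae_restrict_mem measurableSet_Ioi)
  integrable m c hc := by
    rw [integrable_powMeasure_iff]
    have hm : (-1 : ℝ) < r + m - 1 := by
      have : (0 : ℝ) ≤ m := m.cast_nonneg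
      linarith
    refine (integrableOn_rpow_mul_exp_neg_mul_rpow hm one_pos hc).congr_fun
      (fun z hz => ?_) measurableSet_Ioi
    simp only [Real.rpow_one]
    rw [← mul_assoc, rpow_mul_pow hz, neg_mul]
  ne_zero h := by
    have h1 := integral_powMeasure_pow_mul_exp hr 0 one_pos
    rw [h, integral_zero_measure] at h1
    have := Real.Gamma_pos_of_pos (s := r + (0 : ℕ)) (by simpa using hr)
    simp at h1 this
    linarith

lemma mixing_gammaMeasure {r β : ℝ} (hr : 0 < r) (hβ : 0 < β) : Mixing (gammaMeasure r β) := by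
  have := isProbabilityMeasure_gammaMeasure hr hβ
  refine Mixing.of_finite ?_ (IsProbabilityMeasure.ne_zero _)
  rw [gammaMeasure, ae_withDensity_iff (f := gammaPDF r β) (measurable_gammaPDFReal r β).ennreal_ofReal]
  -- The density need not vanish at 0 (for `r = 1` one has `0 ^ 0 = 1`), so that point is discarded
  -- as a null set.
  filter_upwards [Measure.ae_ne volume (0 : ℝ)] with x hx h
  by_contra hneg
  exact h (gammaPDF_of_neg (lt_of_le_of_ne (not_lt.1 hneg) hx))

/-- Substituting `z = x α` turns `α ^ (r - 1) dα` into `x ^ (-r) z ^ (r - 1) dz`; the only remaining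
dependence on `x` is an exponential that tends to 1. -/
lemma integral_gammaMeasure_mul {r β x : ℝ} (hr : 0 < r) (hβ : 0 < β) (hx : 0 < x)
    (g : ℝ → ℝ) :
    ∫ α, g (x * α) ∂(gammaMeasure r β) =
      (β ^ r / Real.Gamma r * x ^ (-r)) *
        ∫ z, Real.exp (-(β / x * z)) * g z ∂(powMeasure r) := by
  rw [gammaMeasure, integral_withDensity_eq_integral_toReal_smul (f := gammaPDF r β)
    (measurable_gammaPDFReal r β).ennreal_ofReal (ae_of_all _ fun _ => ENNReal.ofReal_lt_top),
    ← setIntegral_eq_integral_of_forall_compl_eq_zero (s := Set.Ici 0),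
    integral_Ici_eq_integral_Ioi, integral_powMeasure]
  · have h := integral_comp_mul_left_Ioi
      (fun z => z ^ (r - 1) * (Real.exp (-(β / x * z)) * g z)) 0 hx
    rw [mul_zero, smul_eq_mul, eq_inv_mul_iff_mul_eq₀ hx.ne'] at h
    rw [← h, ← mul_assoc, ← integral_const_mul]
    refine setIntegral_congr_fun measurableSet_Ioi fun α hα => ?_
    have hα' : (0 : ℝ) < α := hα
    simp only [smul_eq_mul]
    rw [gammaPDF, ENNReal.toReal_ofReal (gammaPDFReal_nonneg hr hβ α), gammaPDFReal,
      if_pos hα'.le, Real.mul_rpow hx.le hα'.le, Real.rpow_neg hx.le, Real.rpow_sub_one hx.ne',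
      show β / x * (x * α) = β * α by field_simp]
    have := Real.rpow_pos_of_pos hx r
    field_simp
  · intro α hα
    rw [gammaPDF_of_neg (not_le.1 hα)]
    simp

lemma tendsto_integral_exp_mul {F : Measure ℝ} (hF : ∀ᵐ α ∂F, 0 < α) {β : ℝ} (hβ : 0 < β)
    {g : ℝ → ℝ} (hg : Integrable g F) :
    Tendsto (fun x : ℝ => ∫ z, Real.exp (-(β / x * z)) * g z ∂F) atTop (𝓝 (∫ z, g z ∂F)) := by
  refine tendsto_integral_filter_of_dominated_convergence (fun z => ‖g z‖) ?_ ?_ hg.norm ?_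
  · exact Eventually.of_forall fun x =>
      (Continuous.aestronglyMeasurable (by fun_prop)).mul hg.aestronglyMeasurable
  · filter_upwards [eventually_gt_atTop 0] with x hx
    filter_upwards [hF] with z hz
    rw [norm_mul, Real.norm_eq_abs, abs_of_pos (Real.exp_pos _)]
    refine mul_le_of_le_one_left (norm_nonneg _) (Real.exp_le_one_iff.2 ?_)
    rw [neg_nonpos]; positivity
  · refine ae_of_all _ fun z => ?_
    have h1 : Tendsto (fun x : ℝ => β / x) atTop (𝓝 0) := tendsto_const_nhds.div_atTop tendsto_id
    have h2 := (Real.continuous_exp.tendsto _).comp (h1.mul_const z).neg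
    have h3 := h2.mul_const (g z)
    simpa using h3

section Gamma

variable {r : ℝ} (δ : Fin J → ℝ) (j : Fin J) {p : Fin J → ℝ}

lemma tailH_eq_integral (r : ℝ) (p : Fin J → ℝ) :
    tailH δ r j p = ∫ z, share δ j z p ∂(powMeasure r) :=
  (integral_powMeasure r _).symm

/-- Makes the whole calculus of demand available for `H_j`, with `powMeasure` as the mixing measure.
-/
lemma tailH_eq_demand (r : ℝ) : tailH δ r = demand 1 δ (powMeasure r) := by
  ext j p
  rw [tailH_eq_integral, demand, one_mul]

lemma diagTerm_tailH (hr : 0 < r) (hp : p ∈ PosPrices J) :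
    diagTerm (tailH δ r) j p =
      -2 + (∫ z, share δ j z p ∂(powMeasure r)) * (∫ z, shareD₂ δ j j z p ∂(powMeasure r)) /
        (∫ z, shareD δ j j z p ∂(powMeasure r)) ^ 2 := by
  have := (mixing_powMeasure hr).diagTerm_smul one_pos δ j hp one_pos one_ne_zero
    (fun g => ∫ z, g z ∂(powMeasure r)) (fun g => by simp)
  rwa [one_smul, ← tailH_eq_demand] at this

lemma offDiagTerm_tailH (hr : 0 < r) (k : Fin J) (hp : p ∈ PosPrices J) :
    offDiagTerm (tailH δ r) j k p =
      ((∫ z, share δ j z p ∂(powMeasure r)) * (∫ z, shareD₂ δ j k z p ∂(powMeasure r)) -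
        (∫ z, shareD δ j k z p ∂(powMeasure r)) * (∫ z, shareD δ j j z p ∂(powMeasure r))) /
        (∫ z, shareD δ j j z p ∂(powMeasure r)) ^ 2 := by
  have := (mixing_powMeasure hr).offDiagTerm_smul one_pos δ j k hp one_pos one_ne_zero
    (fun g => ∫ z, g z ∂(powMeasure r)) (fun g => by simp)
  rwa [one_smul, ← tailH_eq_demand] at this

lemma tendsto_diagTerm_gamma {M : ℝ} (hM : 0 < M) (hr : 0 < r) {β : ℝ} (hβ : 0 < β)
    (hp : p ∈ PosPrices J) :
    Tendsto (fun x : ℝ => diagTerm (demand M δ (gammaMeasure r β)) j (x • p)) atTop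
      (𝓝 (diagTerm (tailH δ r) j p)) := by
  have hF := mixing_powMeasure hr
  have h0 := tendsto_integral_exp_mul hF.pos hβ (hF.integrable_share δ j hp)
  have h1 := tendsto_integral_exp_mul hF.pos hβ (hF.hasDerivAt_integral_share δ j j hp).1
  have h2 := tendsto_integral_exp_mul hF.pos hβ (hF.hasDerivAt_integral_shareD δ j j hp).1
  rw [diagTerm_tailH δ j hr hp]
  refine (((h0.mul h2).div (h1.pow 2)
    (pow_ne_zero 2 (hF.integral_shareD_ne_zero δ j j hp))).const_add (-2)).congr' ?_
  filter_upwards [eventually_gt_atTop 0] with x hx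
  have hc : β ^ r / Real.Gamma r * x ^ (-r) ≠ 0 := by
    have := Real.Gamma_pos_of_pos hr
    positivity
  rw [(mixing_gammaMeasure hr hβ).diagTerm_smul hM δ j hp hx hc
    (fun g => ∫ z, Real.exp (-(β / x * z)) * g z ∂(powMeasure r))
    (integral_gammaMeasure_mul hr hβ hx)]
  rfl

lemma tendsto_offDiagTerm_gamma {M : ℝ} (hM : 0 < M) (hr : 0 < r) {β : ℝ} (hβ : 0 < β)
    (k : Fin J) (hp : p ∈ PosPrices J) :
    Tendsto (fun x : ℝ => offDiagTerm (demand M δ (gammaMeasure r β)) j k (x • p)) atTop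
      (𝓝 (offDiagTerm (tailH δ r) j k p)) := by
  have hF := mixing_powMeasure hr
  have h0 := tendsto_integral_exp_mul hF.pos hβ (hF.integrable_share δ j hp)
  have h1 := tendsto_integral_exp_mul hF.pos hβ (hF.hasDerivAt_integral_share δ j j hp).1
  have h1' := tendsto_integral_exp_mul hF.pos hβ (hF.hasDerivAt_integral_share δ j k hp).1
  have h2 := tendsto_integral_exp_mul hF.pos hβ (hF.hasDerivAt_integral_shareD δ j k hp).1
  rw [offDiagTerm_tailH δ j hr k hp]
  refine (((h0.mul h2).sub (h1'.mul h1)).div (h1.pow 2)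
    (pow_ne_zero 2 (hF.integral_shareD_ne_zero δ j j hp))).congr' ?_
  filter_upwards [eventually_gt_atTop 0] with x hx
  have hc : β ^ r / Real.Gamma r * x ^ (-r) ≠ 0 := by
    have := Real.Gamma_pos_of_pos hr
    positivity
  rw [(mixing_gammaMeasure hr hβ).offDiagTerm_smul hM δ j k hp hx hc
    (fun g => ∫ z, Real.exp (-(β / x * z)) * g z ∂(powMeasure r))
    (integral_gammaMeasure_mul hr hβ hx)]
  rfl

/-! ### The market-interaction correction -/

/-- The substitution `u = p_j z` behind the relation between `H_j` and `C_j`. -/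
lemma kernelC_mul (r : ℝ) (hp : p ∈ PosPrices J) {z : ℝ} (hz : 0 < z) :
    kernelC δ r j p (p j * z) =
      p j ^ (r - 1) * Real.exp (-δ j) * (z ^ (r - 1) * share δ j z p) := by
  have hl : ∀ l, p l / p j * (p j * z) = z * p l := fun l => by
    have := hp j
    field_simp
  rw [kernelC, share, Real.mul_rpow (hp j).le hz.le]
  simp only [hl]
  rw [show Real.exp (-(p j * z)) = Real.exp (-δ j) * Real.exp (δ j - z * p j) by
    rw [← Real.exp_add]; congr 1; ring]
  ring

lemma integrableOn_share (hr : 0 < r) (hp : p ∈ PosPrices J) :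
    IntegrableOn (fun z => z ^ (r - 1) * share δ j z p) (Set.Ioi 0) :=
  (integrable_powMeasure_iff r _).1 ((mixing_powMeasure hr).integrable_share δ j hp)

lemma integrableOn_kernelC (hr : 0 < r) (hp : p ∈ PosPrices J) :
    IntegrableOn (kernelC δ r j p) (Set.Ioi 0) := by
  have h := integrableOn_Ioi_comp_mul_left_iff (kernelC δ r j p) 0 (hp j)
  rw [mul_zero] at h
  rw [← h]
  exact IntegrableOn.congr_fun
    ((integrableOn_share δ j hr hp).const_mul (p j ^ (r - 1) * Real.exp (-δ j)))
    (fun z hz => (kernelC_mul δ j r hp hz).symm) measurableSet_Ioi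

lemma tailH_eq (hr : 0 < r) (hp : p ∈ PosPrices J) :
    tailH δ r j p = Real.exp (δ j) * Real.Gamma r * p j ^ (-r) * tailC δ r j p := by
  have h := integral_comp_mul_left_Ioi (kernelC δ r j p) 0 (hp j)
  rw [mul_zero, smul_eq_mul, eq_inv_mul_iff_mul_eq₀ (hp j).ne',
    setIntegral_congr_fun measurableSet_Ioi (fun z hz => kernelC_mul δ j r hp hz),
    integral_const_mul] at h
  rw [tailC, ← h, tailH, Real.rpow_sub_one (hp j).ne', Real.rpow_neg (hp j).le, Real.exp_neg]
  have h1 := Real.Gamma_pos_of_pos hr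
  have h2 := Real.rpow_pos_of_pos (hp j) r
  have h3 := hp j
  field_simp

lemma tailH_pos (hr : 0 < r) (hp : p ∈ PosPrices J) : 0 < tailH δ r j p := by
  rw [tailH_eq_integral]
  exact (mixing_powMeasure hr).integral_share_pos δ j hp

lemma tailC_pos (hr : 0 < r) (hp : p ∈ PosPrices J) : 0 < tailC δ r j p := by
  have h := tailH_pos δ j hr hp
  rw [tailH_eq δ j hr hp] at h
  have := Real.Gamma_pos_of_pos hr
  have := Real.rpow_pos_of_pos (hp j) (-r)
  exact (pos_iff_pos_of_mul_pos h).1 (by positivity)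

/-- Reduces derivatives of `log C_j` to those of `log H_j`, with the extra `r / p_j` from the power
of the own price. -/
lemma logC_eq (hr : 0 < r) (hp : p ∈ PosPrices J) :
    logC δ r j p = r * Real.log (p j) + Real.log (∫ z, share δ j z p ∂(powMeasure r)) -
      Real.log (Real.exp (δ j) * Real.Gamma r) := by
  have h1 := Real.Gamma_pos_of_pos hr
  have h2 := Real.rpow_pos_of_pos (hp j) (-r)
  rw [← tailH_eq_integral, tailH_eq δ j hr hp, Real.log_mul (by positivity) (tailC_pos δ j hr hp).ne',
    Real.log_mul (by positivity) h2.ne', Real.log_rpow (hp j), logC]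
  ring

lemma hasDerivAt_logC (hr : 0 < r) (k : Fin J) (hp : p ∈ PosPrices J) :
    HasDerivAt (fun t => logC δ r j (Function.update p k t))
      ((if k = j then r / p j else 0) + (∫ z, shareD δ j k z p ∂(powMeasure r)) /
        ∫ z, share δ j z p ∂(powMeasure r)) (p k) := by
  have hF := mixing_powMeasure hr
  have h0 := (hF.integral_share_pos δ j hp).ne'
  have h1 := ((hF.hasDerivAt_integral_share δ j k hp).2.log (by simpa using h0))
  have h2 : HasDerivAt (fun t => r * Real.log (Function.update p k t j))
      (if k = j then r / p j else 0) (p k) := by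
    by_cases h : k = j
    · subst h
      simp only [Function.update_self, if_true]
      simpa [div_eq_mul_inv] using (Real.hasDerivAt_log (hp k).ne').const_mul r
    · simp only [Function.update_of_ne (Ne.symm h), if_neg h]
      exact hasDerivAt_const _ _
  have h3 := (h2.add h1).sub_const (Real.log (Real.exp (δ j) * Real.Gamma r))
  simp only [Function.update_eq_self] at h3
  refine h3.congr_of_eventuallyEq ?_
  filter_upwards [Ioi_mem_nhds (hp k)] with t ht
  exact logC_eq δ j hr (update_mem_posPrices hp k ht)

lemma pderiv_logC (hr : 0 < r) (k : Fin J) (hp : p ∈ PosPrices J) :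
    pderiv k (logC δ r j) p = (if k = j then r / p j else 0) +
      (∫ z, shareD δ j k z p ∂(powMeasure r)) / ∫ z, share δ j z p ∂(powMeasure r) :=
  (hasDerivAt_logC δ j hr k hp).deriv

lemma hasDerivAt_pderiv_logC (hr : 0 < r) (k : Fin J) (hp : p ∈ PosPrices J) :
    HasDerivAt (fun t => pderiv k (logC δ r j) (Function.update p j t))
      ((if k = j then -(r / p j ^ 2) else 0) +
        ((∫ z, shareD₂ δ j k z p ∂(powMeasure r)) * (∫ z, share δ j z p ∂(powMeasure r)) -
          (∫ z, shareD δ j k z p ∂(powMeasure r)) * (∫ z, shareD δ j j z p ∂(powMeasure r))) /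
        (∫ z, share δ j z p ∂(powMeasure r)) ^ 2) (p j) := by
  have hF := mixing_powMeasure hr
  have h0 := (hF.integral_share_pos δ j hp).ne'
  have h1 := (hF.hasDerivAt_integral_shareD δ j k hp).2.div
    (hF.hasDerivAt_integral_share δ j j hp).2 (by simpa using h0)
  have h2 : HasDerivAt (fun t => if k = j then r / Function.update p j t j else 0)
      (if k = j then -(r / p j ^ 2) else 0) (p j) := by
    by_cases h : k = j
    · simp only [Function.update_self, if_pos h]
      have := (hasDerivAt_inv (hp j).ne').const_mul r
      simpa [div_eq_mul_inv] using this
    · simp only [if_neg h]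
      exact hasDerivAt_const _ _
  have h3 := h2.add h1
  simp only [Function.update_eq_self] at h3
  refine h3.congr_of_eventuallyEq ?_
  filter_upwards [Ioi_mem_nhds (hp j)] with t ht
  exact pderiv_logC δ j hr k (update_mem_posPrices hp j ht)

/-- The 1 cancels the contribution of `r log p_j`, leaving `-1 / r` times the own-price elasticity
of `H_j`; its sign is then clear because `H_j` decreases in `p_j`. -/
lemma one_add_zetaTerm (hr : 0 < r) (hp : p ∈ PosPrices J) :
    1 + zetaTerm δ r j p = -(p j / r) * ((∫ z, shareD δ j j z p ∂(powMeasure r)) /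
      ∫ z, share δ j z p ∂(powMeasure r)) := by
  rw [zetaTerm, pderiv_logC δ j hr j hp, if_pos rfl]
  have := hp j
  field_simp
  ring

lemma one_add_zetaTerm_pos (hr : 0 < r) (hp : p ∈ PosPrices J) : 0 < 1 + zetaTerm δ r j p := by
  have hF := mixing_powMeasure hr
  rw [one_add_zetaTerm δ j hr hp]
  exact mul_pos_of_neg_of_neg (neg_neg_of_pos (div_pos (hp j) hr))
    (div_neg_of_neg_of_pos (hF.integral_shareD_self_neg δ j hp) (hF.integral_share_pos δ j hp))

/-- Likewise `1 + χ` is `p_j² / r` times `∂_j² log H_j`, so the quotient is `H H'' / H'² - 1`: all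
powers of `p_j` and `r` cancel. -/
lemma gammaDiagLimit_eq (hr : 0 < r) (hp : p ∈ PosPrices J) :
    gammaDiagLimit δ r j p = diagTerm (tailH δ r) j p := by
  have hF := mixing_powMeasure hr
  have h0 := hF.integral_share_pos δ j hp
  have h1 := hF.integral_shareD_ne_zero δ j j hp
  have hj := hp j
  rw [gammaDiagLimit, one_add_zetaTerm δ j hr hp, chiTerm, diagTerm_tailH δ j hr hp, pderiv,
    (hasDerivAt_pderiv_logC δ j hr j hp).deriv, if_pos rfl]
  field_simp
  ring

lemma gammaOffDiagLimit_eq (hr : 0 < r) (k : Fin J) (hp : p ∈ PosPrices J) (hkj : k ≠ j) :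
    gammaOffDiagLimit δ r j k p = offDiagTerm (tailH δ r) j k p := by
  have hF := mixing_powMeasure hr
  have h0 := hF.integral_share_pos δ j hp
  have h1 := hF.integral_shareD_ne_zero δ j j hp
  have hj := hp j
  rw [gammaOffDiagLimit, one_add_zetaTerm δ j hr hp, xiTerm, offDiagTerm_tailH δ j hr k hp, pderiv,
    (hasDerivAt_pderiv_logC δ j hr k hp).deriv, if_neg hkj]
  field_simp
  ring

/-! ### A single inside good -/

lemma tailC_eq_of_unique (hj : ∀ k : Fin J, k = j) (r : ℝ) {p p' : Fin J → ℝ}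
    (hp : p ∈ PosPrices J) (hp' : p' ∈ PosPrices J) : tailC δ r j p = tailC δ r j p' := by
  have h : kernelC δ r j p = kernelC δ r j p' := by
    ext u
    have : ∀ l, p l / p j = p' l / p' j := fun l => by
      rw [hj l, div_self (hp j).ne', div_self (hp' j).ne']
    simp only [kernelC, this]
  rw [tailC, tailC, h]

lemma pderiv_logC_of_unique (hj : ∀ k : Fin J, k = j) (r : ℝ) (hp : p ∈ PosPrices J) :
    pderiv j (logC δ r j) p = 0 := by
  have : (fun t => logC δ r j (Function.update p j t)) =ᶠ[𝓝 (p j)] fun _ => logC δ r j p := by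
    filter_upwards [Ioi_mem_nhds (hp j)] with t ht
    rw [logC, logC, tailC_eq_of_unique δ j hj r (update_mem_posPrices hp j ht) hp]
  rw [pderiv, this.deriv_eq, deriv_const]

lemma pderiv_pderiv_logC_of_unique (hj : ∀ k : Fin J, k = j) (r : ℝ) (hp : p ∈ PosPrices J) :
    pderiv j (pderiv j (logC δ r j)) p = 0 := by
  have : (fun t => pderiv j (logC δ r j) (Function.update p j t)) =ᶠ[𝓝 (p j)] fun _ => 0 := by
    filter_upwards [Ioi_mem_nhds (hp j)] with t ht
    exact pderiv_logC_of_unique δ j hj r (update_mem_posPrices hp j ht)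
  rw [pderiv, this.deriv_eq, deriv_const]

end Gamma

/-! ### Bounds on the limiting demand and its derivatives -/

lemma integral_powMeasure_le {r : ℝ} (hr : 0 < r) (m : ℕ) {c C : ℝ} (hc : 0 < c) {g : ℝ → ℝ}
    (hg : Integrable g (powMeasure r))
    (h : ∀ z, 0 < z → g z ≤ C * (z ^ m * Real.exp (-(c * z)))) :
    ∫ z, g z ∂(powMeasure r) ≤ C * ((1 / c) ^ (r + m) * Real.Gamma (r + m)) := by
  have hF := mixing_powMeasure hr
  rw [← integral_powMeasure_pow_mul_exp hr m hc, ← integral_const_mul]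
  exact integral_mono_ae hg ((hF.integrable m c hc).const_mul C) (hF.pos.mono h)

lemma le_integral_powMeasure {r : ℝ} (hr : 0 < r) (m : ℕ) {c C : ℝ} (hc : 0 < c) {g : ℝ → ℝ}
    (hg : Integrable g (powMeasure r))
    (h : ∀ z, 0 < z → C * (z ^ m * Real.exp (-(c * z))) ≤ g z) :
    C * ((1 / c) ^ (r + m) * Real.Gamma (r + m)) ≤ ∫ z, g z ∂(powMeasure r) := by
  have hF := mixing_powMeasure hr
  rw [← integral_powMeasure_pow_mul_exp hr m hc, ← integral_const_mul]
  exact integral_mono_ae ((hF.integrable m c hc).const_mul C) hg (hF.pos.mono h)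

lemma logit_denom_le (δ : Fin J → ℝ) {α : ℝ} (hα : 0 < α) {p : Fin J → ℝ}
    (hp : p ∈ PosPrices J) :
    1 + ∑ l, Real.exp (δ l - α * p l) ≤ 1 + ∑ l, Real.exp (δ l) := by
  gcongr with l
  have := mul_pos hα (hp l)
  linarith

lemma le_share (δ : Fin J → ℝ) (j : Fin J) {α : ℝ} (hα : 0 < α) {p : Fin J → ℝ}
    (hp : p ∈ PosPrices J) :
    Real.exp (δ j - α * p j) / (1 + ∑ l, Real.exp (δ l)) ≤ share δ j α p :=
  div_le_div_of_nonneg_left (Real.exp_pos _).le (logit_denom_pos δ α p) (logit_denom_le δ hα hp)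

/-- The outside option alone retains at least this probability. -/
lemma le_one_sub_share (δ : Fin J → ℝ) (j : Fin J) {α : ℝ} (hα : 0 < α) {p : Fin J → ℝ}
    (hp : p ∈ PosPrices J) : 1 / (1 + ∑ l, Real.exp (δ l)) ≤ 1 - share δ j α p := by
  have hd := logit_denom_pos δ α p
  refine (one_div_le_one_div_of_le hd (logit_denom_le δ hα hp)).trans ?_
  rw [share, one_sub_div hd.ne']
  refine div_le_div_of_nonneg_right ?_ hd.le
  have := Finset.single_le_sum (f := fun l => Real.exp (δ l - α * p l))
    (fun _ _ => (Real.exp_pos _).le) (Finset.mem_univ j)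
  linarith

section Bounds

variable {r : ℝ} (δ : Fin J → ℝ) (j : Fin J) {p : Fin J → ℝ}

lemma exp_sub_eq (d z c : ℝ) : Real.exp (d - z * c) = Real.exp d * Real.exp (-(c * z)) := by
  rw [← Real.exp_add]; congr 1; ring

lemma integral_share_le (hr : 0 < r) (hp : p ∈ PosPrices J) :
    ∫ z, share δ j z p ∂(powMeasure r) ≤
      Real.exp (δ j) * ((1 / p j) ^ r * Real.Gamma r) := by
  have := integral_powMeasure_le hr 0 (hp j) (C := Real.exp (δ j))
    ((mixing_powMeasure hr).integrable_share δ j hp) fun z _ => by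
      rw [pow_zero, one_mul, ← exp_sub_eq]; exact share_le_exp δ j z p
  simpa using this

lemma le_integral_share (hr : 0 < r) (hp : p ∈ PosPrices J) :
    Real.exp (δ j) / (1 + ∑ l, Real.exp (δ l)) * ((1 / p j) ^ r * Real.Gamma r) ≤
      ∫ z, share δ j z p ∂(powMeasure r) := by
  have := le_integral_powMeasure hr 0 (hp j) (C := Real.exp (δ j) / (1 + ∑ l, Real.exp (δ l)))
    ((mixing_powMeasure hr).integrable_share δ j hp) fun z hz => by
      rw [pow_zero, one_mul, div_mul_eq_mul_div, ← exp_sub_eq]; exact le_share δ j hz hp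
  simpa using this

lemma le_neg_integral_shareD_self (hr : 0 < r) (hp : p ∈ PosPrices J) :
    Real.exp (δ j) / (1 + ∑ l, Real.exp (δ l)) ^ 2 * ((1 / p j) ^ (r + 1) * Real.Gamma (r + 1)) ≤
      -∫ z, shareD δ j j z p ∂(powMeasure r) := by
  have hA : 0 < 1 + ∑ l, Real.exp (δ l) := by positivity
  have := le_integral_powMeasure hr 1 (hp j)
    (C := Real.exp (δ j) / (1 + ∑ l, Real.exp (δ l)) ^ 2)
    ((mixing_powMeasure hr).hasDerivAt_integral_share δ j j hp).1.neg fun z hz => by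
      have h1 := le_share δ j hz hp
      have h2 := le_one_sub_share δ j hz hp
      rw [exp_sub_eq] at h1
      simp only [Pi.neg_apply, shareD, if_true]
      calc _ = z * ((Real.exp (δ j) * Real.exp (-(p j * z)) / (1 + ∑ l, Real.exp (δ l))) *
            (1 / (1 + ∑ l, Real.exp (δ l)))) := by field_simp
        _ ≤ z * (share δ j z p * (1 - share δ j z p)) := by
            have := (share_pos δ j z p).le
            gcongr
        _ = _ := by ring
  simpa [integral_neg] using this

/-- The decay is taken from good `k` rather than `j`: the bound is then uniform as `p_j → 0` and
vanishes as `p_k → ∞`, and both are used. -/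
lemma integral_shareD_le (hr : 0 < r) {k : Fin J} (hkj : k ≠ j) (hp : p ∈ PosPrices J) :
    ∫ z, shareD δ j k z p ∂(powMeasure r) ≤
      Real.exp (δ k) * ((1 / p k) ^ (r + 1) * Real.Gamma (r + 1)) := by
  have := integral_powMeasure_le hr 1 (hp k) (C := Real.exp (δ k))
    ((mixing_powMeasure hr).hasDerivAt_integral_share δ j k hp).1 fun z hz => by
      rw [mul_left_comm, ← exp_sub_eq, pow_one, shareD, if_neg hkj, sub_zero]
      refine mul_le_mul_of_nonneg_left ?_ hz.le
      exact (mul_le_of_le_one_left (share_pos δ k z p).le (share_lt_one δ j z p).le).trans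
        (share_le_exp δ k z p)
  simpa using this

lemma abs_integral_shareD₂_le (hr : 0 < r) {k : Fin J} (hkj : k ≠ j) (hp : p ∈ PosPrices J) :
    |∫ z, shareD₂ δ j k z p ∂(powMeasure r)| ≤
      Real.exp (δ k) * ((1 / p k) ^ (r + 2) * Real.Gamma (r + 2)) := by
  have := integral_powMeasure_le hr 2 (hp k) (C := Real.exp (δ k))
    ((mixing_powMeasure hr).hasDerivAt_integral_shareD δ j k hp).1.abs fun z hz => by
      have hj0 := share_pos δ j z p
      have hj1 := share_lt_one δ j z p
      have hk0 := share_pos δ k z p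
      rw [mul_left_comm, ← exp_sub_eq, shareD₂, if_neg hkj, sub_zero, sub_zero, abs_mul,
        abs_of_nonneg (sq_nonneg z)]
      refine mul_le_mul_of_nonneg_left (le_trans ?_ (share_le_exp δ k z p)) (sq_nonneg z)
      have e : share δ j z p * ((share δ j z p - 1) * share δ k z p + share δ k z p * share δ j z p)
          = share δ k z p * (share δ j z p * (2 * share δ j z p - 1)) := by ring
      rw [e, abs_mul, abs_of_pos hk0, abs_mul, abs_of_pos hj0]
      refine mul_le_of_le_one_right hk0.le (mul_le_one₀ hj1.le (abs_nonneg _) ?_)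
      rw [abs_le]; constructor <;> linarith
  refine (abs_integral_le_integral_abs).trans ?_
  simpa using this

end Bounds

/-! ### Dependence of the limits on the ray -/

section Ray

variable {r : ℝ} (δ : Fin J → ℝ) (j : Fin J) {p : Fin J → ℝ}

lemma hasDerivAt_integral_share_update (hr : 0 < r) (hp : p ∈ PosPrices J) {t : ℝ} (ht : 0 < t) :
    HasDerivAt (fun t => ∫ z, share δ j z (Function.update p j t) ∂(powMeasure r))
      (∫ z, shareD δ j j z (Function.update p j t) ∂(powMeasure r)) t := by
  simpa using ((mixing_powMeasure hr).hasDerivAt_integral_share δ j j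
    (update_mem_posPrices hp j ht)).2

lemma hasDerivAt_integral_shareD_update (hr : 0 < r) (k : Fin J) (hp : p ∈ PosPrices J) {t : ℝ}
    (ht : 0 < t) :
    HasDerivAt (fun t => ∫ z, shareD δ j k z (Function.update p j t) ∂(powMeasure r))
      (∫ z, shareD₂ δ j k z (Function.update p j t) ∂(powMeasure r)) t := by
  simpa using ((mixing_powMeasure hr).hasDerivAt_integral_shareD δ j k
    (update_mem_posPrices hp j ht)).2

lemma eq_of_hasDerivAt_zero_Ioi {φ : ℝ → ℝ} (h : ∀ t, 0 < t → HasDerivAt φ 0 t) {s t : ℝ}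
    (hs : 0 < s) (ht : 0 < t) : φ s = φ t :=
  isOpen_Ioi.is_const_of_deriv_eq_zero isPreconnected_Ioi
    (fun x hx => (h x hx).differentiableAt.differentiableWithinAt)
    (fun x hx => (h x hx).deriv) hs ht

/-- The numerator is that of `∂_j (d / h)` with `h = H_j` and `d = ∂_k H_j`. If it vanished for
every own price, `d / h` would be a positive constant, but `d` stays bounded and `h` grows at least
like `t ^ (-r)` as `t → 0`. -/
lemma exists_offDiagTerm_tailH_ne_zero (hr : 0 < r) {k : Fin J} (hkj : k ≠ j)
    (hp : p ∈ PosPrices J) :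
    ∃ t : ℝ, 0 < t ∧ offDiagTerm (tailH δ r) j k (Function.update p j t) ≠ 0 := by
  by_contra! hcon
  have hF := mixing_powMeasure hr
  set h : ℝ → ℝ := fun t => ∫ z, share δ j z (Function.update p j t) ∂(powMeasure r) with hh
  set d : ℝ → ℝ := fun t => ∫ z, shareD δ j k z (Function.update p j t) ∂(powMeasure r) with hd
  have hpos : ∀ t, 0 < t → 0 < h t := fun t ht =>
    hF.integral_share_pos δ j (update_mem_posPrices hp j ht)
  have hderiv : ∀ t, 0 < t → HasDerivAt (fun t => d t / h t) 0 t := by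
    intro t ht
    have hq := (hasDerivAt_integral_shareD_update δ j hr k hp ht).fun_div
      (hasDerivAt_integral_share_update δ j hr hp ht) (hpos t ht).ne'
    refine hq.congr_deriv ?_
    have h0 := hcon t ht
    rw [offDiagTerm_tailH δ j hr k (update_mem_posPrices hp j ht), div_eq_zero_iff] at h0
    rcases h0 with h0 | h0
    · rw [div_eq_zero_iff]; left; linarith
    · exact absurd h0 (pow_ne_zero 2
        (hF.integral_shareD_ne_zero δ j j (update_mem_posPrices hp j ht)))
  have hconst : ∀ t, 0 < t → d 1 / h 1 = d t / h t := fun t ht =>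
    eq_of_hasDerivAt_zero_Ioi hderiv one_pos ht
  have h1 : 0 < d 1 / h 1 :=
    div_pos (hF.integral_shareD_pos δ hkj (update_mem_posPrices hp j one_pos)) (hpos 1 one_pos)
  set K := Real.exp (δ k) * ((1 / p k) ^ (r + 1) * Real.Gamma (r + 1)) with hK
  set K' := Real.exp (δ j) / (1 + ∑ l, Real.exp (δ l)) * Real.Gamma r with hK'
  have hK0 : 0 < K' := by
    have := Real.Gamma_pos_of_pos hr
    positivity
  have hbound : ∀ t, 0 < t → d 1 / h 1 ≤ K / K' * t ^ r := by
    intro t ht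
    have e1 : d t ≤ K := by
      have := integral_shareD_le δ j hr hkj (update_mem_posPrices hp j ht)
      rwa [Function.update_of_ne hkj] at this
    have e2 : K' * (1 / t) ^ r ≤ h t := by
      have := le_integral_share δ j hr (update_mem_posPrices hp j ht)
      rw [Function.update_self] at this
      calc _ = _ := by rw [hK']; ring
        _ ≤ _ := this
    have e0 : 0 < d t := hF.integral_shareD_pos δ hkj (update_mem_posPrices hp j ht)
    have htr := Real.rpow_pos_of_pos ht r
    have htr' : 0 < (1 / t) ^ r := Real.rpow_pos_of_pos (by positivity) r
    rw [hconst t ht]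
    calc d t / h t ≤ K / (K' * (1 / t) ^ r) := by gcongr; exact e0.le.trans e1
      _ = K / K' * t ^ r := by
        rw [one_div, Real.inv_rpow ht.le]; field_simp
  have hlim : Tendsto (fun t : ℝ => K / K' * t ^ r) (𝓝[>] 0) (𝓝 (K / K' * 0)) := by
    have := (Real.continuousAt_rpow_const 0 r (Or.inr hr.le)).tendsto
    rw [Real.zero_rpow hr.ne'] at this
    exact (this.mono_left nhdsWithin_le_nhds).const_mul _
  rw [mul_zero] at hlim
  have := ge_of_tendsto hlim (eventually_mem_nhdsWithin.mono fun t ht => hbound t ht)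
  linarith

/-- As `p_k → ∞`, `H_j` stays bounded and its own derivative stays away from 0, while both cross
derivatives decay like negative powers of `p_k`. -/
lemma tendsto_offDiagTerm_tailH_zero (hr : 0 < r) {k : Fin J} (hkj : k ≠ j)
    (hp : p ∈ PosPrices J) :
    Tendsto (fun t : ℝ => offDiagTerm (tailH δ r) j k (Function.update p k t)) atTop (𝓝 0) := by
  have hF := mixing_powMeasure hr
  set A := Real.exp (δ j) * ((1 / p j) ^ r * Real.Gamma r) with hA
  set B := Real.exp (δ j) / (1 + ∑ l, Real.exp (δ l)) ^ 2 *
    ((1 / p j) ^ (r + 1) * Real.Gamma (r + 1)) with hB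
  have hB0 : 0 < B := by
    have := Real.Gamma_pos_of_pos (add_pos hr one_pos)
    have := hp j
    positivity
  have hA0 : 0 < A := by
    have := Real.Gamma_pos_of_pos hr
    have := hp j
    positivity
  have hlim : ∀ s : ℝ, 0 < s → Tendsto (fun t : ℝ => (1 / t) ^ s) atTop (𝓝 0) := fun s hs => by
    refine (tendsto_rpow_neg_atTop hs).congr' ?_
    filter_upwards [eventually_gt_atTop 0] with t ht
    rw [one_div, Real.inv_rpow ht.le, Real.rpow_neg ht.le]
  have hl : Tendsto (fun t : ℝ =>
      A * (Real.exp (δ k) * ((1 / t) ^ (r + 2) * Real.Gamma (r + 2))) / B ^ 2 +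
      Real.exp (δ k) * ((1 / t) ^ (r + 1) * Real.Gamma (r + 1)) / B) atTop (𝓝 0) := by
    have h1 := (((((hlim (r + 2) (by linarith)).mul_const (Real.Gamma (r + 2))).const_mul
      (Real.exp (δ k))).const_mul A).div_const (B ^ 2))
    have h2 := ((((hlim (r + 1) (by linarith)).mul_const (Real.Gamma (r + 1))).const_mul
      (Real.exp (δ k))).div_const B)
    simpa using h1.add h2
  refine squeeze_zero_norm' ?_ hl
  filter_upwards [eventually_gt_atTop 0] with t ht
  have hq := update_mem_posPrices hp k ht
  have b0 := integral_share_le δ j hr hq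
  have b1 := le_neg_integral_shareD_self δ j hr hq
  have b2 := integral_shareD_le δ j hr hkj hq
  have b3 := abs_integral_shareD₂_le δ j hr hkj hq
  rw [Function.update_of_ne (Ne.symm hkj)] at b0 b1
  rw [Function.update_self] at b2 b3
  have c0 := hF.integral_share_pos δ j hq
  have c1 := hF.integral_shareD_self_neg δ j hq
  have c2 := hF.integral_shareD_pos δ hkj hq
  rw [offDiagTerm_tailH δ j hr k hq, Real.norm_eq_abs]
  generalize (∫ z, share δ j z (Function.update p k t) ∂(powMeasure r)) = h at *
  generalize (∫ z, shareD δ j k z (Function.update p k t) ∂(powMeasure r)) = d at *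
  generalize (∫ z, shareD δ j j z (Function.update p k t) ∂(powMeasure r)) = e at *
  generalize (∫ z, shareD₂ δ j k z (Function.update p k t) ∂(powMeasure r)) = f at *
  have e1 : |(h * f - d * e) / e ^ 2| ≤ h * |f| / (-e) ^ 2 + d / (-e) := by
    have : (h * f - d * e) / e ^ 2 = h * f / e ^ 2 - d / e := by
      have := c1.ne
      field_simp
    rw [this]
    refine (abs_sub _ _).trans ?_
    rw [abs_div, abs_div, abs_mul, abs_of_pos c0, abs_of_pos c2, abs_of_neg c1, neg_sq,
      abs_of_nonneg (sq_nonneg e)]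
  refine e1.trans ?_
  have hen : B ≤ -e := b1
  have hd0 := c2.le.trans b2
  have hf0 := (abs_nonneg f).trans b3
  gcongr

/-- A higher own price lowers every ratio `p_l / p_j` with `l ≠ j`, which enlarges the denominator
of the kernel, strictly because of good `k`. -/
lemma tailC_update_ne (hr : 0 < r) {k : Fin J} (hkj : k ≠ j) :
    tailC δ r j (Function.update 1 j 1) ≠ tailC δ r j (Function.update 1 j 2) := by
  have hone : (1 : Fin J → ℝ) ∈ PosPrices J := fun i => one_pos
  have hp1 := update_mem_posPrices hone j (one_pos (α := ℝ))
  have hp2 := update_mem_posPrices hone j (two_pos (α := ℝ))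
  have i1 := integrableOn_kernelC δ j hr hp1
  have i2 := integrableOn_kernelC δ j hr hp2
  have hne : (volume.restrict (Set.Ioi (0 : ℝ))) ≠ 0 := by
    rw [Ne, Measure.restrict_eq_zero]; simp
  have hpos := integral_pos_of_ae_pos hne (i1.sub i2) (by
    filter_upwards [ae_restrict_mem measurableSet_Ioi] with u hu
    have hu' : (0 : ℝ) < u := hu
    rw [Pi.sub_apply, sub_pos]
    simp only [kernelC, Function.update_self]
    refine div_lt_div_of_pos_left (mul_pos (Real.rpow_pos_of_pos hu' _) (Real.exp_pos _))
      (by positivity) ?_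
    refine add_lt_add_of_le_of_lt le_rfl (Finset.sum_lt_sum (fun l _ => ?_)
      ⟨k, Finset.mem_univ k, ?_⟩)
    · by_cases hl : l = j
      · subst hl; simp
      · simp only [Function.update_of_ne hl, Pi.one_apply]
        apply Real.exp_le_exp.2; linarith
    · simp only [Function.update_of_ne hkj, Pi.one_apply]
      apply Real.exp_lt_exp.2; linarith)
  simp only [Pi.sub_apply] at hpos
  rw [integral_sub i1 i2, sub_pos] at hpos
  intro heq
  rw [tailC, tailC] at heq
  have := Real.Gamma_pos_of_pos hr
  exact hpos.ne' (mul_left_cancel₀ (by positivity) heq)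

/-- If the diagonal limit does not depend on the price of good `j`, demand is a power of that
price. -/
lemma integral_share_power_of_diagTerm_const (hr : 0 < r) (hp : p ∈ PosPrices J) {c : ℝ}
    (hc : ∀ t : ℝ, 0 < t → diagTerm (tailH δ r) j (Function.update p j t) = -1 + c) :
    ∃ κ B : ℝ, ∀ t : ℝ, 0 < t →
      Real.log (∫ z, share δ j z (Function.update p j t) ∂(powMeasure r)) =
        B - κ * Real.log t := by
  have hF := mixing_powMeasure hr
  set h : ℝ → ℝ := fun t => ∫ z, share δ j z (Function.update p j t) ∂(powMeasure r) with hh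
  set d : ℝ → ℝ := fun t => ∫ z, shareD δ j j z (Function.update p j t) ∂(powMeasure r) with hd
  have hpos : ∀ t, 0 < t → 0 < h t := fun t ht =>
    hF.integral_share_pos δ j (update_mem_posPrices hp j ht)
  have hneg : ∀ t, 0 < t → d t < 0 := fun t ht =>
    hF.integral_shareD_self_neg δ j (update_mem_posPrices hp j ht)
  have hdh : ∀ t, 0 < t → HasDerivAt h (d t) t := fun t ht =>
    hasDerivAt_integral_share_update δ j hr hp ht
  -- With `d = h'`, `(h / h')' = 1 - h h'' / h'²`, which the hypothesis makes equal to `-c`.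
  have hderiv : ∀ t, 0 < t → HasDerivAt (fun t => h t / d t + c * t) 0 t := by
    intro t ht
    have hq := ((hdh t ht).fun_div (hasDerivAt_integral_shareD_update δ j hr j hp ht)
      (hneg t ht).ne).add ((hasDerivAt_id t).const_mul c)
    refine hq.congr_deriv ?_
    have h0 := hc t ht
    rw [diagTerm_tailH δ j hr (update_mem_posPrices hp j ht)] at h0
    have h2 := (hneg t ht).ne
    simp only [hd] at h2
    have h3 : c = -1 + (∫ z, share δ j z (Function.update p j t) ∂(powMeasure r)) *
        (∫ z, shareD₂ δ j j z (Function.update p j t) ∂(powMeasure r)) /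
        (∫ z, shareD δ j j z (Function.update p j t) ∂(powMeasure r)) ^ 2 := by linarith
    rw [h3]
    simp only [hd]
    field_simp
    ring
  set K := (1 + ∑ l, Real.exp (δ l)) ^ 2 / r with hK
  have hbound : ∀ t, 0 < t → |h t / d t| ≤ K * t := by
    intro t ht
    have e1 : h t ≤ _ := integral_share_le δ j hr (update_mem_posPrices hp j ht)
    have e2 : _ ≤ -d t := le_neg_integral_shareD_self δ j hr (update_mem_posPrices hp j ht)
    rw [Function.update_self] at e1 e2
    rw [abs_div, abs_of_pos (hpos t ht), abs_of_neg (hneg t ht),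
      div_le_iff₀ (neg_pos.2 (hneg t ht))]
    refine e1.trans (le_trans (le_of_eq ?_) (mul_le_mul_of_nonneg_left e2 (by positivity)))
    rw [Real.Gamma_add_one hr.ne', Real.rpow_add_one (by positivity), hK]
    have hA : 0 < 1 + ∑ l, Real.exp (δ l) := by positivity
    field_simp
  -- The constant of integration is found at `t → 0`, where both terms are `O(t)`. Hence `h' / h =
  -- -1 / (c t)`, and `h` is a power.
  have hzero : ∀ t, 0 < t → h t / d t + c * t = 0 := by
    intro t ht
    have h1 : Tendsto (fun s : ℝ => h s / d s + c * s) (𝓝[>] 0) (𝓝 0) := by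
      refine squeeze_zero_norm' (a := fun s => (K + |c|) * s) ?_ ?_
      · filter_upwards [self_mem_nhdsWithin] with s hs
        have hs' : (0 : ℝ) < s := hs
        refine (norm_add_le _ _).trans ?_
        rw [Real.norm_eq_abs, Real.norm_eq_abs, abs_mul, abs_of_pos hs', add_mul]
        exact add_le_add (hbound s hs') le_rfl
      · have : Tendsto (fun s : ℝ => (K + |c|) * s) (𝓝 0) (𝓝 ((K + |c|) * 0)) :=
          tendsto_id.const_mul _
        rw [mul_zero] at this
        exact this.mono_left nhdsWithin_le_nhds
    have h2 : Tendsto (fun s : ℝ => h s / d s + c * s) (𝓝[>] 0) (𝓝 (h t / d t + c * t)) := by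
      refine tendsto_const_nhds.congr' ?_
      filter_upwards [self_mem_nhdsWithin] with s hs
      exact eq_of_hasDerivAt_zero_Ioi hderiv ht hs
    exact tendsto_nhds_unique h2 h1
  have hc0 : c ≠ 0 := by
    rintro rfl
    have := hzero 1 one_pos
    rw [zero_mul, add_zero, div_eq_zero_iff] at this
    rcases this with h | h
    · exact (hpos 1 one_pos).ne' h
    · exact (hneg 1 one_pos).ne h
  have hlog : ∀ t, 0 < t → HasDerivAt (fun t => Real.log (h t) + 1 / c * Real.log t) 0 t := by
    intro t ht
    refine (((hdh t ht).log (hpos t ht).ne').add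
      ((Real.hasDerivAt_log ht.ne').const_mul (1 / c))).congr_deriv ?_
    have h1 := hzero t ht
    have h2 := (hneg t ht).ne
    have h3 := (hpos t ht).ne'
    have h4 : h t = -(c * t) * d t := by
      field_simp at h1
      linarith
    field_simp
    rw [h4]; ring
  refine ⟨1 / c, Real.log (h 1) + 1 / c * Real.log 1, fun t ht => ?_⟩
  have := eq_of_hasDerivAt_zero_Ioi hlog one_pos ht
  linarith

lemma exists_diagTerm_tailH_ne (hr : 0 < r) {k : Fin J} (hkj : k ≠ j) :
    ∃ p ∈ PosPrices J, ∃ p' ∈ PosPrices J,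
      diagTerm (tailH δ r) j p ≠ diagTerm (tailH δ r) j p' := by
  by_contra! hcon
  have hone : (1 : Fin J → ℝ) ∈ PosPrices J := fun i => one_pos
  obtain ⟨κ, B, hB⟩ := integral_share_power_of_diagTerm_const δ j hr hone
    (c := diagTerm (tailH δ r) j 1 + 1) fun t ht => by
      rw [hcon _ (update_mem_posPrices hone j ht) 1 hone]; ring
  have hG := Real.Gamma_pos_of_pos hr
  have hκ : κ = r := by
    by_contra hne
    have hne' : r - κ ≠ 0 := sub_ne_zero.2 (Ne.symm hne)
    -- With `s = log t` ranging over all reals, an affine function bounded above has slope 0, so the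
    -- upper bound on `H_j` alone determines `κ`.
    have hup : ∀ s : ℝ, B + (r - κ) * s ≤ Real.log (Real.exp (δ j) * Real.Gamma r) := by
      intro s
      have hq := update_mem_posPrices hone j (Real.exp_pos s)
      have h1 := Real.log_le_log ((mixing_powMeasure hr).integral_share_pos δ j hq)
        (integral_share_le δ j hr hq)
      rw [hB _ (Real.exp_pos s), Function.update_self, Real.log_exp, mul_left_comm,
        Real.log_mul (by positivity) (by positivity), Real.log_rpow (by positivity), one_div,
        Real.log_inv, Real.log_exp] at h1
      linarith
    have := hup ((Real.log (Real.exp (δ j) * Real.Gamma r) - B + 1) / (r - κ))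
    rw [mul_div_cancel₀ _ hne'] at this
    linarith
  subst hκ
  have hlogC : ∀ t : ℝ, 0 < t → logC δ κ j (Function.update 1 j t) =
      B - Real.log (Real.exp (δ j) * Real.Gamma κ) := fun t ht => by
    rw [logC_eq δ j hr (update_mem_posPrices hone j ht), hB t ht, Function.update_self]
    ring
  refine tailC_update_ne δ j hr hkj ?_
  have h1 := tailC_pos δ j hr (update_mem_posPrices hone j one_pos)
  have h2 := tailC_pos δ j hr (update_mem_posPrices hone j two_pos)
  exact Real.log_injOn_pos h1 h2 ((hlogC 1 one_pos).trans (hlogC 2 two_pos).symm)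

/-- A constant value would equal both a nonzero value and the limit 0 as `p_k → ∞`. -/
lemma exists_offDiagTerm_tailH_ne (hr : 0 < r) {k : Fin J} (hkj : k ≠ j) :
    ∃ p ∈ PosPrices J, ∃ p' ∈ PosPrices J,
      offDiagTerm (tailH δ r) j k p ≠ offDiagTerm (tailH δ r) j k p' := by
  by_contra! hcon
  have hone : (1 : Fin J → ℝ) ∈ PosPrices J := fun i => one_pos
  obtain ⟨t, ht, hne⟩ := exists_offDiagTerm_tailH_ne_zero δ j hr hkj hone
  refine hne (tendsto_nhds_unique (tendsto_const_nhds.congr' ?_)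
    (tendsto_offDiagTerm_tailH_zero δ j hr hkj hone))
  filter_upwards [eventually_gt_atTop 0] with s hs
  exact hcon _ (update_mem_posPrices hone j ht) _ (update_mem_posPrices hone k hs)

end Ray

end MixedLogit

open MixedLogit in
theorem mainTheorem1 {J : ℕ} (δ : Fin J → ℝ) (M : ℝ) (hM : 0 < M) :
    -- (a) log-normal mixing
    (∀ μ σ : ℝ, 0 < σ →
      Regular (demand M δ (logNormal μ σ)) ∧
      ∀ p ∈ PosPrices J, ∀ lam : ℕ → ℝ, Tendsto lam atTop atTop → ∀ j : Fin J,
        Tendsto (fun n => diagTerm (demand M δ (logNormal μ σ)) j (lam n • p))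
          atTop (𝓝 (-1)) ∧
        ∀ k : Fin J, k ≠ j →
          Tendsto (fun n => offDiagTerm (demand M δ (logNormal μ σ)) j k (lam n • p))
            atTop (𝓝 0)) ∧
    -- (b) gamma mixing with shape `r` and rate `β`
    (∀ r β : ℝ, 0 < r → 0 < β →
      Regular (demand M δ (gammaMeasure r β)) ∧
      -- `H_j` and `C_j` are finite, `H_j = e^{δ_j} Γ(r) p_j^{-r} C_j`, and the quantities
      -- built from `log C_j` are well defined
      (∀ p ∈ PosPrices J, ∀ j : Fin J,
        IntegrableOn (fun z => z ^ (r - 1) * share δ j z p) (Set.Ioi 0) ∧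
        IntegrableOn (kernelC δ r j p) (Set.Ioi 0) ∧
        tailH δ r j p = Real.exp (δ j) * Real.Gamma r * p j ^ (-r) * tailC δ r j p ∧
        0 < tailC δ r j p ∧
        (∀ k : Fin J, HasPartialAt k (logC δ r j) p ∧
          HasPartialAt j (pderiv k (logC δ r j)) p) ∧
        0 < 1 + zetaTerm δ r j p) ∧
      -- the limits along every ray
      (∀ p ∈ PosPrices J, ∀ lam : ℕ → ℝ, Tendsto lam atTop atTop → ∀ j : Fin J,
        Tendsto (fun n => diagTerm (demand M δ (gammaMeasure r β)) j (lam n • p))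
          atTop (𝓝 (gammaDiagLimit δ r j p)) ∧
        ∀ k : Fin J, k ≠ j →
          Tendsto (fun n => offDiagTerm (demand M δ (gammaMeasure r β)) j k (lam n • p))
            atTop (𝓝 (gammaOffDiagLimit δ r j k p))) ∧
      -- no competing inside goods
      (∀ j : Fin J, (∀ k : Fin J, k = j) →
        (∀ p ∈ PosPrices J, ∀ p' ∈ PosPrices J, tailC δ r j p = tailC δ r j p') ∧
        ∀ p ∈ PosPrices J,
          zetaTerm δ r j p = 0 ∧ chiTerm δ r j p = 0 ∧
          ∀ lam : ℕ → ℝ, Tendsto lam atTop atTop →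
            Tendsto (fun n => diagTerm (demand M δ (gammaMeasure r β)) j (lam n • p))
              atTop (𝓝 (-1 + 1 / r))) ∧
      -- with competing inside goods the limits depend on the ray, and the off-diagonal
      -- limit does not vanish identically
      (∀ j k : Fin J, k ≠ j →
        (∃ p ∈ PosPrices J, ∃ p' ∈ PosPrices J,
          gammaDiagLimit δ r j p ≠ gammaDiagLimit δ r j p') ∧
        (∃ p ∈ PosPrices J, ∃ p' ∈ PosPrices J,
          gammaOffDiagLimit δ r j k p ≠ gammaOffDiagLimit δ r j k p') ∧
        (∃ p ∈ PosPrices J, gammaOffDiagLimit δ r j k p ≠ 0))) := by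
  refine ⟨fun μ σ hσ => ⟨(mixing_logNormal μ).regular hM δ, fun p hp lam hlam j =>
    ⟨(tendsto_diagTerm_logNormal hM δ μ hσ j hp).comp hlam, fun k hkj =>
      (tendsto_offDiagTerm_logNormal hM δ μ hσ hkj hp).comp hlam⟩⟩, fun r β hr hβ => ?_⟩
  have hdiag : ∀ p ∈ PosPrices J, ∀ lam : ℕ → ℝ, Tendsto lam atTop atTop → ∀ j : Fin J,
      Tendsto (fun n => diagTerm (demand M δ (gammaMeasure r β)) j (lam n • p))
        atTop (𝓝 (gammaDiagLimit δ r j p)) := fun p hp lam hlam j => by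
    rw [gammaDiagLimit_eq δ j hr hp]
    exact (tendsto_diagTerm_gamma δ j hM hr hβ hp).comp hlam
  refine ⟨(mixing_gammaMeasure hr hβ).regular hM δ, fun p hp j =>
    ⟨integrableOn_share δ j hr hp, integrableOn_kernelC δ j hr hp, tailH_eq δ j hr hp,
      tailC_pos δ j hr hp, fun k => ⟨(hasDerivAt_logC δ j hr k hp).differentiableAt,
        (hasDerivAt_pderiv_logC δ j hr k hp).differentiableAt⟩, one_add_zetaTerm_pos δ j hr hp⟩,
    fun p hp lam hlam j => ⟨hdiag p hp lam hlam j, fun k hkj => ?_⟩, fun j hj =>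
    ⟨fun p hp p' hp' => tailC_eq_of_unique δ j hj r hp hp', fun p hp => ?_⟩, fun j k hkj => ?_⟩
  · rw [gammaOffDiagLimit_eq δ j hr k hp hkj]
    exact (tendsto_offDiagTerm_gamma δ j hM hr hβ k hp).comp hlam
  · have hζ : zetaTerm δ r j p = 0 := by
      rw [zetaTerm, pderiv_logC_of_unique δ j hj r hp, mul_zero]
    have hχ : chiTerm δ r j p = 0 := by
      rw [chiTerm, pderiv_pderiv_logC_of_unique δ j hj r hp, mul_zero]
    refine ⟨hζ, hχ, fun lam hlam => ?_⟩
    have := hdiag p hp lam hlam j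
    rw [gammaDiagLimit, hζ, hχ] at this
    simpa using this
  · have hone : (1 : Fin J → ℝ) ∈ PosPrices J := fun _ => one_pos
    refine ⟨?_, ?_, ?_⟩
    · obtain ⟨p, hp, p', hp', h⟩ := exists_diagTerm_tailH_ne δ j hr hkj
      refine ⟨p, hp, p', hp', ?_⟩
      rwa [gammaDiagLimit_eq δ j hr hp, gammaDiagLimit_eq δ j hr hp']
    · obtain ⟨p, hp, p', hp', h⟩ := exists_offDiagTerm_tailH_ne δ j hr hkj
      refine ⟨p, hp, p', hp', ?_⟩
      rwa [gammaOffDiagLimit_eq δ j hr k hp hkj, gammaOffDiagLimit_eq δ j hr k hp' hkj]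
    · obtain ⟨t, ht, h⟩ := exists_offDiagTerm_tailH_ne_zero δ j hr hkj hone
      refine ⟨_, update_mem_posPrices hone j ht, ?_⟩
      rwa [gammaOffDiagLimit_eq δ j hr k (update_mem_posPrices hone j ht) hkj]
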